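/- **Setting.** Let $\mathcal M$ be a smooth Riemannian manifold of dimension $d\ge 1$ with a retraction, i.e. a smooth map $\mathrm{Retr}\colon \mathrm T\mathcal M\to\mathcal M$ with $\mathrm{Retr}_x(0)=x$ and $\mathrm D\,\mathrm{Retr}_x(0)=\mathrm{Id}$ for all $x$. Let $f\colon\mathcal M\to\mathbb R$ be twice continuously differentiable, with pullbacks $\hat f_x=f\circ\mathrm{Retr}_x\colon \mathrm T_x\mathcal M\to\mathbb R$. Assume * (A1) $f(x)\ge f^*$ for all $x\in\mathcal M$; * (A2) there are $b_1\in(0,\infty]$, $L>0$ with $\|\nabla\hat f_x(s)-\nabla\hat f_x(0)\|\le L\|s\|$ for all $x\in\mathcal M$ and $s\in\mathrm T_x\mathcal M$ with $\|s\|\le b_1$; * (A3) there are $b_2\in(0,\infty]$, $\rho>0$ with $\|\nabla^2\hat f_x(s)-\nabla^2\hat f_x(0)\|\le\rho\|s\|$ (operator norm) for all $x\in\mathcal M$ and $s\in\mathrm T_x\mathcal M$ with $\|s\|\le b_2$. Put $b=\min\{b_1,b_2\}$. If $b<\infty$, there is $\ell\in[L,L+\rho b]$ such that for every $x$ the map $\nabla\hat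 f_x$ is $\ell$-Lipschitz on $\{s\in \mathrm T_x\mathcal M:\|s\|\le b\}$. In what follows let $\ell\ge L$ be any number with this Lipschitz property. **Algorithm** $\mathrm{PRGD}(x_0,\eta,r,\mathscr T,\epsilon,T,b)$. Start with $t=0$. While $t\le T$: if $\|\mathrm{grad} f(x_t)\|>\epsilon$, set $x_{t+1}=\mathrm{TSS}(x_t,0,1)$ and $t\leftarrow t+1$; otherwise draw $\xi$ uniformly from the closed ball of radius $r$ around $0$ in $\mathrm T_{x_t}\mathcal M$ (independently of the past), set $x_{t+\mathscr T}=\mathrm{TSS}(x_t,\eta\xi,\mathscr T)$ and $t\leftarrow t+\mathscr T$. Here $\mathrm{TSS}(x,s_0,n)$ performs the steps $s_{j+1}=s_j-\eta\nabla\hat f_x(s_j)$, $j=0,\dots,n-1$, and returns $\mathrm{Retr}_x(s_n)$, except that at the first $j$ with $\|s_{j+1}\|\ge b$ it stops and returns $\mathrm{Retr}_x(s_j-\alpha\eta\nabla\hat f_x(s_j))$ with $\alpha\in(0,1]$ such that $\|s_j-\alpha\eta\nabla\hat f_x(s_j)\|=b$. The algorithm accesses $f$ only through gradients (no function or Hessian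 queries). The iterates visited are the $x_t$ at which a round of the loop is started. **Parameters.** Let $x_0\in\mathcal M$, $\Delta=f(x_0)-f^*$, $0<\epsilon\le b^2\rho$, $L\ge\sqrt{\rho\epsilon}$, $\epsilon^{3/2}\le 3\sqrt\rho\,\Delta$, $\delta\in(0,1)$, and $\kappa=\dfrac{\ell^2\Delta}{\delta\sqrt\rho\,\epsilon^{5/2}}$ (then $3\kappa>1$). Call $\chi>1/4$ admissible if $\chi\ge 4\log_2\bigl(2^{31}\sqrt d\,\kappa\bigr)$ and $\mathscr T=\ell\chi/\sqrt{\rho\epsilon}$ is an integer. Put $$\eta=\frac1\ell,\quad r=\frac{\epsilon}{400\chi^3},\quad \mathscr F=\frac1{50\chi^3}\sqrt{\frac{\epsilon^3}{\rho}},\quad T=8\max\Bigl\{\frac{\mathscr T}3,\ \frac{\Delta\,\mathscr T}{\mathscr F},\ \frac{\Delta}{\eta\epsilon^2}\Bigr\}.$$ **Theorem.** 1. There is an absolute constant $C$ such that some admissible $\chi$ exists for which $$T\le C\,\frac{\ell\Delta}{\epsilon^2}\,\bigl(1+\log d+\log(3\kappa)\bigr)^4,\qquad\text{and, if } d\ge2,\qquad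 T\le C\,\bigl(1+\log(3\kappa)\bigr)^4\,\frac{\ell\Delta}{\epsilon^2}(\log d)^4 ;$$ that is, $T=O\bigl(\ell(f(x_0)-f^*)(\log d)^4/\epsilon^2\bigr)$ up to logarithmic factors in the other parameters. 2. For every admissible $\chi$ and every outcome of the perturbations, $\mathrm{PRGD}(x_0,\eta,r,\mathscr T,\epsilon,T,b)$ terminates with $T<t\le T+\mathscr T\le 2T$ and visits at least two iterates $x_t$ with $\|\mathrm{grad} f(x_t)\|\le\epsilon$. The gradient steps use at most $T+\mathscr T\le 2T$ gradient queries, and the total number of gradient queries, with one more counted for each test $\|\mathrm{grad} f(x_t)\|>\epsilon$, is at most $2T$. 3. For every admissible $\chi$, with probability at least $1-\delta$, at least two-thirds of the visited iterates with $\|\mathrm{grad} f(x_t)\|\le\epsilon$ also satisfy $\lambda_{\min}(\nabla^2\hat f_{x_t}(0))\ge-\sqrt{\rho\epsilon}$. -/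

import Mathlib

open scoped Manifold ContDiff Bundle ENNReal

noncomputable section

/-! ## The algorithm

The algorithm is written over an abstract family `V x` of (tangent) spaces and sees the cost
function only through two gradient oracles: `g x` (the gradient at a point of the manifold) and
`G x s` (the gradient of the pullback at a tangent vector). In particular it can make no function
or Hessian queries. -/

namespace PRGD

section TangentSpaceSteps

variable {V : Type*} [NormedAddCommGroup V] [InnerProductSpace ℝ V]

/-- The number `α ∈ (0, 1]` with `‖s - α v‖ = b` (it exists and is unique as soon as
`‖s‖ < b ≤ ‖s - v‖`; the default `1` is never used by the algorithm then). -/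
def exitFraction (b : ℝ≥0∞) (s v : V) : ℝ :=
  open Classical in
  if h : ∃ α : ℝ, 0 < α ∧ α ≤ 1 ∧ ‖s - α • v‖ₑ = b then h.choose else 1

/-- At most `n` gradient steps of length `η` from `s` with gradient oracle `G`, stopped on the
sphere of radius `b` as soon as an iterate leaves the interior of the ball of radius `b`
(`b = ∞` is allowed, then this never happens).
Returns the last tangent vector and the number of calls to `G`. -/
def tangentSpaceSteps (G : V → V) (η : ℝ) (b : ℝ≥0∞) : ℕ → V → V × ℕ
  | 0, s => (s, 0)
  | n + 1, s =>
    open Classical in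
    if b ≤ ‖s - η • G s‖ₑ then
      (s - (exitFraction b s (η • G s) * η) • G s, 1)
    else
      ((tangentSpaceSteps G η b n (s - η • G s)).1,
        (tangentSpaceSteps G η b n (s - η • G s)).2 + 1)

/-- The uniform probability distribution on the closed ball of radius `r` around the origin of a
Euclidean space `V`, for the Lebesgue measure of its inner product. -/
def uniformBall (V : Type*) [NormedAddCommGroup V] [InnerProductSpace ℝ V] [FiniteDimensional ℝ V]
    (r : ℝ) : @MeasureTheory.Measure V (borel V) :=
  letI : MeasurableSpace V := borel V
  haveI : BorelSpace V := ⟨rfl⟩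
  ProbabilityTheory.cond MeasureTheory.volume (Metric.closedBall (0 : V) r)

end TangentSpaceSteps

/-- Parameters `η, r, 𝒯, ε, T, b` of the algorithm. -/
structure Params where
  η : ℝ
  r : ℝ
  𝒯 : ℕ
  ε : ℝ
  T : ℝ
  b : ℝ≥0∞

/-- State of the algorithm at the head of its main loop: the current iterate `x_t`, the counter
`t`, the list of all iterates processed in earlier rounds (in order, so each of them was reached
with counter at most `T`), and the number of gradient queries made so far inside
`tangentSpaceSteps`. -/
structure State (M : Type*) where
  point : M
  time : ℕ
  visited : List M
  stepQueries : ℕ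

/-- Initial state. -/
def State.init {M : Type*} (x₀ : M) : State M := ⟨x₀, 0, [], 0⟩

/-- Total number of gradient queries: those made by the steps, and one for the test on the norm of
the gradient at each processed iterate. -/
def State.queries {M : Type*} (S : State M) : ℕ := S.stepQueries + S.visited.length

section Loop

variable {M : Type*} {V : M → Type*} [∀ x, NormedAddCommGroup (V x)]
  [∀ x, InnerProductSpace ℝ (V x)]

/-- One call of `tangentSpaceSteps` at the current point from `s₀` with `n` steps, followed by a
retraction; the counter grows by `n`. -/
def State.move (p : Params) (G : ∀ x, V x → V x) (R : ∀ x, V x → M) (S : State M) (n : ℕ)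
    (s₀ : V S.point) : State M where
  point := R S.point (tangentSpaceSteps (G S.point) p.η p.b n s₀).1
  time := S.time + n
  visited := S.visited ++ [S.point]
  stepQueries := S.stepQueries + (tangentSpaceSteps (G S.point) p.η p.b n s₀).2

/-- The main loop, run for at most `n` rounds, for a given outcome of the perturbations: in the
round where `k` further rounds are left, the perturbation at `x` is `ζ k x`. -/
def exec (p : Params) (g : ∀ x, V x) (G : ∀ x, V x → V x) (R : ∀ x, V x → M)
    (ζ : ℕ → ∀ x, V x) : ℕ → State M → State M
  | 0, S => S
  | k + 1, S =>
    open Classical in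
    if (S.time : ℝ) ≤ p.T then
      if p.ε < ‖g S.point‖ then
        exec p g G R ζ k (S.move p G R 1 0)
      else
        exec p g G R ζ k (S.move p G R p.𝒯 (p.η • ζ k S.point))
    else S

/-- The main loop, run for at most `n` rounds, with random perturbations: `expect p g G R φ n S` is
the expectation of `φ` at the final state of the run started at `S`. A perturbation at `x` is drawn
uniformly from the ball of radius `r` of `V x`, independently of the past, so that the law of the
run is the iterated integral below. (For functions that are not measurable this is the iterated
lower integral, so that lower bounds on it are the strongest ones.) -/
def expect [∀ x, FiniteDimensional ℝ (V x)] (p : Params) (g : ∀ x, V x) (G : ∀ x, V x → V x)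
    (R : ∀ x, V x → M) (φ : State M → ℝ≥0∞) : ℕ → State M → ℝ≥0∞
  | 0, S => φ S
  | k + 1, S =>
    open Classical in
    if (S.time : ℝ) ≤ p.T then
      if p.ε < ‖g S.point‖ then
        expect p g G R φ k (S.move p G R 1 0)
      else
        @MeasureTheory.lintegral (V S.point) (borel (V S.point)) (uniformBall (V S.point) p.r)
          (fun ξ => expect p g G R φ k (S.move p G R p.𝒯 (p.η • ξ)))
    else φ S

/-- Number of rounds after which the loop has certainly ended: the counter is a natural number that
grows in each round (when `𝒯 ≥ 1`), and the loop goes on while it is at most `T`. -/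
def Params.rounds (p : Params) : ℕ := ⌊p.T⌋₊ + 1

/-- Final state of the algorithm started at `x₀`, for a given outcome `ζ` of the perturbations. -/
def run (p : Params) (g : ∀ x, V x) (G : ∀ x, V x → V x) (R : ∀ x, V x → M) (x₀ : M)
    (ζ : ℕ → ∀ x, V x) : State M :=
  exec p g G R ζ p.rounds (State.init x₀)

/-- Probability that the final state of the algorithm started at `x₀` lies in `A`. -/
def prob [∀ x, FiniteDimensional ℝ (V x)] (p : Params) (g : ∀ x, V x) (G : ∀ x, V x → V x)
    (R : ∀ x, V x → M) (x₀ : M) (A : Set (State M)) : ℝ≥0∞ :=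
  expect p g G R (A.indicator 1) p.rounds (State.init x₀)

end Loop

/-! ## Calculus in a Euclidean space -/

section Euclidean

variable {V : Type*} [NormedAddCommGroup V] [InnerProductSpace ℝ V] [CompleteSpace V]

/-- Hessian of `φ` at `s`, the derivative of the gradient, as a linear operator on `V`. -/
def hessian (φ : V → ℝ) (s : V) : V →L[ℝ] V := fderiv ℝ (gradient φ) s

/-- `‖∇φ(s) - ∇φ(0)‖ ≤ L ‖s‖` in the ball of radius `b`. -/
def GradBound (φ : V → ℝ) (b : ℝ≥0∞) (L : ℝ) : Prop :=
  ∀ s : V, ‖s‖ₑ ≤ b → ‖gradient φ s - gradient φ 0‖ ≤ L * ‖s‖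

/-- `‖∇²φ(s) - ∇²φ(0)‖ ≤ ρ ‖s‖` (operator norm) in the ball of radius `b`. -/
def HessBound (φ : V → ℝ) (b : ℝ≥0∞) (ρ : ℝ) : Prop :=
  ∀ s : V, ‖s‖ₑ ≤ b → ‖hessian φ s - hessian φ 0‖ ≤ ρ * ‖s‖

/-- `∇φ` is `ℓ`-Lipschitz in the ball of radius `b`. -/
def GradLipschitz (φ : V → ℝ) (b : ℝ≥0∞) (ℓ : ℝ) : Prop :=
  ∀ s s' : V, ‖s‖ₑ ≤ b → ‖s'‖ₑ ≤ b → ‖gradient φ s - gradient φ s'‖ ≤ ℓ * ‖s - s'‖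

/-- Smallest eigenvalue of a symmetric operator. -/
def lambdaMin (A : V →L[ℝ] V) : ℝ :=
  sInf {μ : ℝ | Module.End.HasEigenvalue (A : V →ₗ[ℝ] V) μ}

end Euclidean

/-! ## Riemannian manifolds, retractions, pullbacks -/

section Manifold

variable {d : ℕ} {M : Type*} [TopologicalSpace M] [ChartedSpace (EuclideanSpace ℝ (Fin d)) M]

instance (x : M) : FiniteDimensional ℝ (TangentSpace (𝓡 d) x) :=
  inferInstanceAs (FiniteDimensional ℝ (EuclideanSpace ℝ (Fin d)))

variable [Bundle.RiemannianBundle (fun x : M => TangentSpace (𝓡 d) x)]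

instance (x : M) : CompleteSpace (TangentSpace (𝓡 d) x) :=
  FiniteDimensional.complete ℝ _

/-- A retraction: a smooth map `TM → M` whose restriction to each tangent space `T_x M` maps `0` to
`x`, with the identity as differential at `0`. -/
structure IsRetraction [IsManifold (𝓡 d) ∞ M] (Retr : TangentBundle (𝓡 d) M → M) : Prop where
  smooth : ContMDiff (𝓡 d).tangent (𝓡 d) ∞ Retr
  map_zero : ∀ x : M, Retr ⟨x, 0⟩ = x
  deriv_zero : ∀ x : M,
    HasMFDerivAt 𝓘(ℝ, TangentSpace (𝓡 d) x) (𝓡 d)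
      (fun s : TangentSpace (𝓡 d) x => Retr ⟨x, s⟩) 0
      (ContinuousLinearMap.id ℝ (TangentSpace (𝓡 d) x))

/-- The Riemannian gradient: `⟨grad f x, s⟩ = Df(x)[s]` for all `s ∈ T_x M`. -/
def grad (f : M → ℝ) (x : M) : TangentSpace (𝓡 d) x :=
  (InnerProductSpace.toDual ℝ (TangentSpace (𝓡 d) x)).symm (mfderiv (𝓡 d) 𝓘(ℝ, ℝ) f x)

/-- The pullback `f ∘ Retr_x` to the tangent space at `x`. -/
def pullback (Retr : TangentBundle (𝓡 d) M → M) (f : M → ℝ) (x : M) :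
    TangentSpace (𝓡 d) x → ℝ :=
  fun s => f (Retr ⟨x, s⟩)

variable (d) in
open Classical in
/-- Number of processed iterates with gradient norm at most `ε`. -/
def numSmallGrad (f : M → ℝ) (ε : ℝ) (S : State M) : ℕ :=
  S.visited.countP fun x => decide (‖grad (d := d) f x‖ ≤ ε)

open Classical in
/-- Number of processed iterates with gradient norm at most `ε` at which moreover the smallest
eigenvalue of the Hessian of the pullback at the origin is at least `-√(ρ ε)`. -/
def numSecondOrder (Retr : TangentBundle (𝓡 d) M → M) (f : M → ℝ) (ρ ε : ℝ) (S : State M) : ℕ :=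
  S.visited.countP fun x =>
    decide (‖grad (d := d) f x‖ ≤ ε ∧ -√(ρ * ε) ≤ lambdaMin (hessian (pullback Retr f x) 0))

end Manifold

/-! ## Choice of the parameters -/

/-- The ratio `ℓ² Δ / (δ √ρ ε^{5/2})`, where `Δ` stands for `f(x₀) - f*`. -/
def kappa (ℓ ρ ε δ Δ : ℝ) : ℝ := ℓ ^ 2 * Δ / (δ * √ρ * ε ^ (5 / 2 : ℝ))

/-- Admissible pairs `(χ, 𝒯)`: `χ > 1/4` satisfies the lower bound
`χ ≥ 4 log₂(2³¹ ℓ² √d Δ / (δ √ρ ε^{5/2}))`, and `𝒯 = ℓ χ / √(ρ ε)` is an integer. -/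
def Admissible (d : ℕ) (ℓ ρ ε δ Δ χ : ℝ) (𝒯 : ℕ) : Prop :=
  1 / 4 < χ ∧ 4 * Real.logb 2 (2 ^ 31 * √(d : ℝ) * kappa ℓ ρ ε δ Δ) ≤ χ ∧
    (𝒯 : ℝ) = ℓ * χ / √(ρ * ε)

/-- `ℱ = (1 / (50 χ³)) √(ε³ / ρ)`. -/
def decrease (ρ ε χ : ℝ) : ℝ := 1 / (50 * χ ^ 3) * √(ε ^ 3 / ρ)

/-- `T = 8 max {𝒯 / 3, Δ 𝒯 / ℱ, Δ / (η ε²)}` with `η = 1 / ℓ`. -/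
def horizon (ℓ ρ ε Δ χ : ℝ) (𝒯 : ℕ) : ℝ :=
  8 * max ((𝒯 : ℝ) / 3) (max (Δ * 𝒯 / decrease ρ ε χ) (Δ / (1 / ℓ * ε ^ 2)))

/-- `η = 1 / ℓ`, `r = ε / (400 χ³)`, and `T` as above. -/
def params (ℓ ρ ε Δ χ : ℝ) (𝒯 : ℕ) (b : ℝ≥0∞) : Params where
  η := 1 / ℓ
  r := ε / (400 * χ ^ 3)
  𝒯 := 𝒯
  ε := ε
  T := horizon ℓ ρ ε Δ χ 𝒯
  b := b

end PRGD

end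

noncomputable section

namespace PRGD

/-! ## Calculus in a Euclidean space -/

section Calculus

open scoped InnerProductSpace

variable {V : Type*} [NormedAddCommGroup V] [InnerProductSpace ℝ V]

/-! The function value is a budget: `f` can fall by at most `Δ` in total. Write `σ = √(ρε)`. A round
with large gradient takes one unit of time and lowers `f` by at least `ε²/(2ℓ)`
(`GradLipschitz.large_round`). A round with small gradient takes `𝒯` units and raises `f` by at most
`c = ε²/(320ℓχ³) ≤ (5/32)ℱ`, whatever the perturbation (`GradLipschitz.small_round`). If moreover
`λ_min < -σ`, then with high probability it lowers `f` by at least `ℱ`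
(`GradLipschitz.saddle_round`).

The saddle estimate couples two runs. A run that fails to lower the value by `ℱ` cannot travel far
("improve or localize"), so it stays in a ball of radius `R = ε/(4σχ)`, where gradient descent is
nearly the linear map `1 - η∇²φ(0)`. Two such runs whose starts differ along the lowest eigenvector
separate by a factor of at least `2^χ`, up to a constant, which the ball permits only if the starts
are extremely close. Hence the bad perturbations meet every line in that direction in a very short
set. Such a set has many disjoint translates in a slightly larger ball, so its probability is tiny
(`cond_closedBall_le_of_thin`).

At most `⌊T/𝒯⌋ + 1` perturbations are drawn, so a union bound leaves failure probability at most
`δ`. Outside that event, if more than a third of the small-gradient rounds were at saddles, spending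
the budget would take no longer than `T`, although the loop ends only after `T`
(`Accounting.two_mul_smallCount_le`). The claims valid for every outcome use the same accounting
with saddle rounds credited only with `-c`. -/

lemma convex_setOf_enorm_le (b : ℝ≥0∞) : Convex ℝ {s : V | ‖s‖ₑ ≤ b} := by
  induction b with
  | top => simpa using convex_univ
  | coe b =>
    have : {s : V | ‖s‖ₑ ≤ (b : ℝ≥0∞)} = Metric.closedBall 0 (b : ℝ) := by
      ext s
      simp only [Set.mem_ofPred_eq, mem_closedBall_zero_iff, enorm, ENNReal.coe_le_coe]
      rfl
    rw [this]
    exact convex_closedBall _ _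

lemma enorm_le_of_norm_le {E : Type*} [SeminormedAddCommGroup E] {s : E} {R : ℝ}
    {b : ℝ≥0∞} (hb : ENNReal.ofReal R ≤ b) (hs : ‖s‖ ≤ R) : ‖s‖ₑ ≤ b := by
  rw [← ofReal_norm]
  exact (ENNReal.ofReal_le_ofReal hs).trans hb

lemma enorm_add_smul_le {b : ℝ≥0∞} {s v : V} (hs : ‖s‖ₑ ≤ b) (hv : ‖s + v‖ₑ ≤ b) {t : ℝ}
    (ht : t ∈ Set.Icc (0 : ℝ) 1) : ‖s + t • v‖ₑ ≤ b :=
  (convex_setOf_enorm_le b).add_smul_mem (x := s) (y := v) hs hv ht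

variable [CompleteSpace V] {φ : V → ℝ} {b : ℝ≥0∞} {L ℓ ρ : ℝ}

lemma differentiable_gradient (hφ : ContDiff ℝ 2 φ) : Differentiable ℝ (gradient φ) := by
  have h : Differentiable ℝ (fderiv ℝ φ) :=
    (hφ.fderiv_right (m := 1) le_rfl).differentiable one_ne_zero
  exact ((InnerProductSpace.toDual ℝ V).symm.toContinuousLinearEquiv.differentiable).comp h

/-- The Hessian is the derivative of the gradient. The Riesz isomorphism turns it into the second
Fréchet derivative, whose symmetry then makes it a symmetric operator. -/
lemma inner_hessian (hφ : ContDiff ℝ 2 φ) (s v w : V) :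
    ⟪hessian φ s v, w⟫_ℝ = fderiv ℝ (fderiv ℝ φ) s v w := by
  have h : HasFDerivAt (gradient φ) (hessian φ s) s := (differentiable_gradient hφ s).hasFDerivAt
  have h' : HasFDerivAt (fun x => InnerProductSpace.toDual ℝ V (gradient φ x))
      ((InnerProductSpace.toDual ℝ V).toContinuousLinearEquiv.toContinuousLinearMap.comp
        (hessian φ s)) s :=
    ((InnerProductSpace.toDual ℝ V).toContinuousLinearEquiv.toContinuousLinearMap.hasFDerivAt).comp
      s h
  have h2 : (fun x => InnerProductSpace.toDual ℝ V (gradient φ x)) = fderiv ℝ φ := by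
    funext x
    exact toDual_gradient
  rw [h2] at h'
  rw [h'.fderiv]
  rfl

lemma isSymmetric_hessian (hφ : ContDiff ℝ 2 φ) (s : V) :
    (hessian φ s : V →ₗ[ℝ] V).IsSymmetric := by
  intro v w
  have hsym : IsSymmSndFDerivAt ℝ φ s := hφ.contDiffAt.isSymmSndFDerivAt (by simp)
  simp only [ContinuousLinearMap.coe_coe]
  rw [inner_hessian hφ, real_inner_comm, inner_hessian hφ]
  exact hsym v w

/-- The quadratic upper bound for a function with Lipschitz gradient. -/
lemma GradLipschitz.apply_add_le (hφ : ContDiff ℝ 2 φ) (h : GradLipschitz φ b ℓ) {s v : V}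
    (hs : ‖s‖ₑ ≤ b) (hv : ‖s + v‖ₑ ≤ b) :
    φ (s + v) ≤ φ s + ⟪gradient φ s, v⟫_ℝ + ℓ / 2 * ‖v‖ ^ 2 := by
  -- On the segment, `φ` minus the linear and quadratic terms of the claimed bound. The Lipschitz
  -- condition makes it antitone, and its values at `0` and `1` give the claim.
  set u : ℝ → ℝ := fun t => φ (s + t • v) - t * ⟪gradient φ s, v⟫_ℝ - ℓ / 2 * t ^ 2 * ‖v‖ ^ 2
  have hd : ∀ t, HasDerivAt u
      (⟪gradient φ (s + t • v), v⟫_ℝ - ⟪gradient φ s, v⟫_ℝ - ℓ * t * ‖v‖ ^ 2) t := by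
    intro t
    have h1 : HasDerivAt (fun t : ℝ => s + t • v) v t := by
      simpa using ((hasDerivAt_id t).smul_const v).const_add s
    have h2 : HasDerivAt (fun t : ℝ => φ (s + t • v)) (⟪gradient φ (s + t • v), v⟫_ℝ) t := by
      have := ((hφ.differentiable two_ne_zero) (s + t • v)).hasFDerivAt.comp_hasDerivAt t h1
      rwa [← inner_gradient_left] at this
    have h3 := (h2.sub ((hasDerivAt_id t).mul_const ⟪gradient φ s, v⟫_ℝ)).sub
      ((((hasDerivAt_id t).pow 2).const_mul (ℓ / 2)).mul_const (‖v‖ ^ 2))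
    refine h3.congr_deriv ?_
    simp only [id]
    push_cast
    ring
  have hanti : AntitoneOn u (Set.Icc 0 1) := by
    refine antitoneOn_of_deriv_nonpos (convex_Icc 0 1)
      (fun t _ => (hd t).continuousAt.continuousWithinAt)
      (fun t _ => (hd t).differentiableAt.differentiableWithinAt) fun t ht => ?_
    rw [interior_Icc] at ht
    rw [(hd t).deriv, ← inner_sub_left]
    have h1 := h (s + t • v) s (enorm_add_smul_le hs hv ⟨ht.1.le, ht.2.le⟩) hs
    have h2 := real_inner_le_norm (gradient φ (s + t • v) - gradient φ s) v
    have h3 : ‖s + t • v - s‖ = t * ‖v‖ := by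
      rw [add_sub_cancel_left, norm_smul, Real.norm_of_nonneg ht.1.le]
    rw [h3] at h1
    nlinarith [mul_le_mul_of_nonneg_right h1 (norm_nonneg v)]
  have := hanti (Set.left_mem_Icc.2 zero_le_one) (Set.right_mem_Icc.2 zero_le_one) zero_le_one
  simp only [u, one_smul, zero_smul, add_zero] at this
  linarith

/-- A gradient step of length `η ≤ 1 / ℓ` that stays in the ball. -/
lemma GradLipschitz.apply_step_le (hφ : ContDiff ℝ 2 φ) (h : GradLipschitz φ b ℓ) {s : V} {η : ℝ}
    (hη : 0 ≤ η) (hηℓ : η * ℓ ≤ 1)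
    (hs : ‖s‖ₑ ≤ b) (hv : ‖s - η • gradient φ s‖ₑ ≤ b) :
    φ (s - η • gradient φ s) ≤ φ s - η / 2 * ‖gradient φ s‖ ^ 2 := by
  have := h.apply_add_le hφ (v := -(η • gradient φ s)) hs (by rwa [← sub_eq_add_neg])
  rw [← sub_eq_add_neg, inner_neg_right, inner_smul_right, real_inner_self_eq_norm_sq, norm_neg,
    norm_smul, Real.norm_of_nonneg hη, mul_pow] at this
  have h2 : 0 ≤ ‖gradient φ s‖ ^ 2 := by positivity
  nlinarith [mul_nonneg (mul_nonneg hη h2) (sub_nonneg.2 hηℓ)]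

/-- A growth bound on `∇φ` near `0` passes to its derivative at `0`; `0 < b` makes the ball a
neighbourhood of `0`. -/
lemma GradBound.norm_hessian_zero_le (hφ : ContDiff ℝ 2 φ) (hb : 0 < b) (hL : 0 ≤ L)
    (h : GradBound φ b L) : ‖hessian φ 0‖ ≤ L := by
  refine (differentiable_gradient hφ 0).hasFDerivAt.le_of_lip' hL ?_
  have hc : Filter.Tendsto (fun s : V => ‖s‖ₑ) (nhds 0) (nhds 0) := by
    simpa using (continuous_enorm (E := V)).tendsto 0
  filter_upwards [hc.eventually (gt_mem_nhds hb)] with s hs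
  simpa using h s hs.le

lemma HessBound.gradLipschitz (hφ : ContDiff ℝ 2 φ) (hb : 0 < b) (hb' : b ≠ ⊤) (hL : 0 ≤ L)
    (hρ : 0 ≤ ρ) (h₁ : GradBound φ b L) (h₂ : HessBound φ b ρ) :
    GradLipschitz φ b (L + ρ * b.toReal) := by
  intro s s' hs hs'
  refine (convex_setOf_enorm_le b).norm_image_sub_le_of_norm_fderiv_le
    (fun x _ => differentiable_gradient hφ x) (fun x hx => ?_) hs' hs
  have hx' : ‖x‖ ≤ b.toReal := by
    rw [← toReal_enorm]
    exact ENNReal.toReal_mono hb' hx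
  calc ‖hessian φ x‖ = ‖hessian φ 0 + (hessian φ x - hessian φ 0)‖ := by rw [add_sub_cancel]
    _ ≤ ‖hessian φ 0‖ + ‖hessian φ x - hessian φ 0‖ := norm_add_le _ _
    _ ≤ L + ρ * ‖x‖ := add_le_add (h₁.norm_hessian_zero_le hφ hb hL) (h₂ x hx)
    _ ≤ L + ρ * b.toReal := by gcongr

/-- Mean value inequality for `∇φ - ∇²φ(0)`: it controls how far gradient descent near the origin
deviates from its linearization. -/
lemma HessBound.norm_gradient_sub_sub_le (hφ : ContDiff ℝ 2 φ) (hρ : 0 ≤ ρ) (h : HessBound φ b ρ)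
    {R : ℝ} (hR : ENNReal.ofReal R ≤ b) {s s' : V} (hs : ‖s‖ ≤ R) (hs' : ‖s'‖ ≤ R) :
    ‖gradient φ s - gradient φ s' - hessian φ 0 (s - s')‖ ≤ ρ * R * ‖s - s'‖ := by
  refine (convex_closedBall (0 : V) R).norm_image_sub_le_of_norm_fderiv_le'
    (fun x _ => differentiable_gradient hφ x) (fun x hx => ?_)
    (mem_closedBall_zero_iff.2 hs') (mem_closedBall_zero_iff.2 hs)
  have hx' := mem_closedBall_zero_iff.1 hx
  exact (h x (enorm_le_of_norm_le hR hx')).trans (by gcongr)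

end Calculus

/-! ## The smallest eigenvalue of a symmetric operator -/

section Eigenvalues

open scoped InnerProductSpace

variable {V : Type*} [NormedAddCommGroup V] [InnerProductSpace ℝ V] [FiniteDimensional ℝ V]
  {A : V →L[ℝ] V}

lemma finite_setOf_hasEigenvalue (A : V →L[ℝ] V) :
    {μ : ℝ | Module.End.HasEigenvalue (A : V →ₗ[ℝ] V) μ}.Finite :=
  Module.End.finite_hasEigenvalue (A : V →ₗ[ℝ] V)

lemma lambdaMin_le {μ : ℝ} (hμ : Module.End.HasEigenvalue (A : V →ₗ[ℝ] V) μ) : lambdaMin A ≤ μ :=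
  csInf_le (finite_setOf_hasEigenvalue A).bddBelow hμ

lemma exists_eigenvector_lambdaMin [Nontrivial V] (hA : (A : V →ₗ[ℝ] V).IsSymmetric) :
    ∃ e : V, ‖e‖ = 1 ∧ A e = lambdaMin A • e := by
  have hne : {μ : ℝ | Module.End.HasEigenvalue (A : V →ₗ[ℝ] V) μ}.Nonempty :=
    ⟨hA.eigenvalues rfl ⟨0, Module.finrank_pos⟩, hA.hasEigenvalue_eigenvalues rfl _⟩
  have hmem : Module.End.HasEigenvalue (A : V →ₗ[ℝ] V) (lambdaMin A) :=
    hne.csInf_mem (finite_setOf_hasEigenvalue A)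
  obtain ⟨v, hv⟩ := hmem.exists_hasEigenvector
  have hv0 : ‖v‖ ≠ 0 := norm_ne_zero_iff.2 hv.2
  refine ⟨‖v‖⁻¹ • v, ?_, ?_⟩
  · rw [norm_smul, norm_inv, norm_norm, inv_mul_cancel₀ hv0]
  · have : A v = lambdaMin A • v := hv.apply_eq_smul
    rw [map_smul, this, smul_comm]

/-- For `0 ≤ η ≤ 1 / ‖A‖` the operator `1 - η A` has norm at most `1 - η λ_min(A)`. -/
lemma norm_sub_smul_apply_le (hA : (A : V →ₗ[ℝ] V).IsSymmetric) {η : ℝ} (hη : 0 ≤ η)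
    (hηA : η * ‖A‖ ≤ 1) (v : V) : ‖v - η • A v‖ ≤ |1 - η * lambdaMin A| * ‖v‖ := by
  refine le_of_sq_le_sq ?_ (by positivity)
  rw [mul_pow]
  set B := hA.eigenvectorBasis rfl
  rw [← B.sum_sq_norm_inner_right v, ← B.sum_sq_norm_inner_right (v - η • A v), Finset.mul_sum]
  refine Finset.sum_le_sum fun i _ => ?_
  set μ := hA.eigenvalues rfl i
  have hμe : A (B i) = μ • B i := hA.apply_eigenvectorBasis rfl i
  have hin : ⟪B i, A v⟫_ℝ = μ * ⟪B i, v⟫_ℝ := by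
    have := hA (B i) v
    simp only [ContinuousLinearMap.coe_coe] at this
    rw [← this, hμe, inner_smul_left]
    simp
  have hmin : lambdaMin A ≤ μ := lambdaMin_le (hA.hasEigenvalue_eigenvalues rfl i)
  have hμ : μ ≤ ‖A‖ := by
    have h1 := A.le_opNorm (B i)
    rw [hμe, norm_smul, B.norm_eq_one, mul_one, mul_one] at h1
    exact (le_abs_self μ).trans h1
  rw [inner_sub_right, inner_smul_right, hin, sq_abs]
  simp only [Real.norm_eq_abs, sq_abs]
  -- In the eigenbasis each coefficient is multiplied by `1 - ημ`. Since `η‖A‖ ≤ 1`, these factors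
  -- are nonnegative, so the one at `λ_min` bounds them all in absolute value.
  have h1 : 0 ≤ 1 - η * μ := by nlinarith
  have h2 : 1 - η * μ ≤ 1 - η * lambdaMin A := by nlinarith
  have : ⟪B i, v⟫_ℝ - η * (μ * ⟪B i, v⟫_ℝ) = (1 - η * μ) * ⟪B i, v⟫_ℝ := by ring
  rw [this, mul_pow]
  gcongr

end Eigenvalues

/-! ## Steps in a tangent space -/

section Steps

variable {V : Type*} [NormedAddCommGroup V] [InnerProductSpace ℝ V]

lemma exitFraction_spec {b : ℝ≥0∞} {s v : V} (hs : ‖s‖ₑ < b) (hv : b ≤ ‖s - v‖ₑ) :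
    0 < exitFraction b s v ∧ exitFraction b s v ≤ 1 ∧ ‖s - exitFraction b s v • v‖ₑ = b := by
  have h : ∃ α : ℝ, 0 < α ∧ α ≤ 1 ∧ ‖s - α • v‖ₑ = b := by
    have hc : ContinuousOn (fun α : ℝ => ‖s - α • v‖ₑ) (Set.Icc 0 1) := by fun_prop
    obtain ⟨α, hα, hαb⟩ := intermediate_value_Icc zero_le_one hc
      (show b ∈ Set.Icc _ _ from ⟨by simpa using hs.le, by simpa using hv⟩)
    refine ⟨α, hα.1.lt_of_ne ?_, hα.2, hαb⟩
    rintro rfl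
    simp only [zero_smul, sub_zero] at hαb
    exact hs.ne hαb
  unfold exitFraction
  rw [dif_pos h]
  exact h.choose_spec

lemma tangentSpaceSteps_queries_le (G : V → V) (η : ℝ) (b : ℝ≥0∞) (n : ℕ) (s : V) :
    (tangentSpaceSteps G η b n s).2 ≤ n := by
  induction n generalizing s with
  | zero => simp [tangentSpaceSteps]
  | succ n ih =>
    simp only [tangentSpaceSteps]
    split_ifs
    · simp
    · simpa using ih _

/-- The gradient step `s ↦ s - η G(s)`. -/
def gradStep (G : V → V) (η : ℝ) (s : V) : V := s - η • G s

/-- A run either never leaves the open ball, and then ends with an iterate of the gradient step,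
or it ends on the sphere. -/
lemma tangentSpaceSteps_eq_or {G : V → V} {η : ℝ} {b : ℝ≥0∞} (n : ℕ) {s : V} (hs : ‖s‖ₑ < b) :
    (∀ j ≤ n, ‖(gradStep G η)^[j] s‖ₑ < b ∧
      tangentSpaceSteps G η b j s = ((gradStep G η)^[j] s, j)) ∨
      ‖(tangentSpaceSteps G η b n s).1‖ₑ = b := by
  induction n generalizing s with
  | zero =>
    refine Or.inl fun j hj => ?_
    obtain rfl : j = 0 := by omega
    exact ⟨hs, rfl⟩
  | succ n ih =>
    by_cases h : b ≤ ‖s - η • G s‖ₑ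
    · refine Or.inr ?_
      simp only [tangentSpaceSteps, if_pos h]
      rw [mul_smul]
      exact (exitFraction_spec hs h).2.2
    · rcases ih (not_le.1 h) with h' | h'
      · refine Or.inl fun j hj => ?_
        cases j with
        | zero => exact ⟨hs, rfl⟩
        | succ j =>
          obtain ⟨h1, h2⟩ := h' j (by omega)
          refine ⟨h1, ?_⟩
          simp only [tangentSpaceSteps, if_neg h]
          rw [h2]
          rfl
      · refine Or.inr ?_
        simpa only [tangentSpaceSteps, if_neg h] using h'

variable [CompleteSpace V] {φ : V → ℝ} {b : ℝ≥0∞} {ℓ η : ℝ}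

/-- Improve or localize: a run that moves far decreases the function value. -/
lemma GradLipschitz.tangentSpaceSteps (hφ : ContDiff ℝ 2 φ) (h : GradLipschitz φ b ℓ)
    (hη : 0 < η) (hℓ : 0 ≤ ℓ) (hηℓ : η * ℓ ≤ 1) (n : ℕ) {s : V} (hs : ‖s‖ₑ < b) :
    φ (tangentSpaceSteps (gradient φ) η b n s).1 ≤ φ s ∧
    ‖(tangentSpaceSteps (gradient φ) η b n s).1 - s‖ ^ 2 ≤
      2 * n * η * (φ s - φ (tangentSpaceSteps (gradient φ) η b n s).1) := by
  induction n generalizing s with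
  | zero => simp [PRGD.tangentSpaceSteps]
  | succ n ih =>
    by_cases hb : b ≤ ‖s - η • gradient φ s‖ₑ
    · simp only [PRGD.tangentSpaceSteps, if_pos hb]
      obtain ⟨hα0, hα1, hαb⟩ := exitFraction_spec hs hb
      set α := exitFraction b s (η • gradient φ s)
      rw [← mul_smul] at hαb
      have hαη : 0 < α * η := mul_pos hα0 hη
      have hle : α * η ≤ η := mul_le_of_le_one_left hη.le hα1
      have hstep := h.apply_step_le hφ hαη.le ((mul_le_mul_of_nonneg_right hle hℓ).trans hηℓ)
        hs.le hαb.le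
      have hg : 0 ≤ ‖gradient φ s‖ ^ 2 := by positivity
      have hdec : 0 ≤ φ s - φ (s - (α * η) • gradient φ s) := by nlinarith
      refine ⟨by linarith, ?_⟩
      rw [sub_sub_cancel_left, norm_neg, norm_smul, Real.norm_of_nonneg hαη.le, mul_pow]
      push_cast
      calc (α * η) ^ 2 * ‖gradient φ s‖ ^ 2
          = 2 * (α * η) * (α * η / 2 * ‖gradient φ s‖ ^ 2) := by ring
        _ ≤ 2 * (α * η) * (φ s - φ (s - (α * η) • gradient φ s)) := by gcongr; linarith
        _ ≤ 2 * (n + 1) * η * (φ s - φ (s - (α * η) • gradient φ s)) := by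
            gcongr ?_ * _
            have : (0 : ℝ) ≤ n := n.cast_nonneg
            nlinarith
    · simp only [PRGD.tangentSpaceSteps, if_neg hb]
      have hs1 := not_le.1 hb
      obtain ⟨h1, h2⟩ := ih hs1
      have hstep := h.apply_step_le hφ hη.le hηℓ hs.le hs1.le
      set s1 := s - η • gradient φ s with hs1def
      set o := (PRGD.tangentSpaceSteps (gradient φ) η b n s1).1
      have hg : 0 ≤ ‖gradient φ s‖ ^ 2 := by positivity
      have ha : 0 ≤ φ s - φ s1 := by nlinarith
      refine ⟨by linarith, ?_⟩
      have hA : ‖s1 - s‖ ^ 2 ≤ 2 * η * (φ s - φ s1) := by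
        rw [hs1def, sub_sub_cancel_left, norm_neg, norm_smul, Real.norm_of_nonneg hη.le, mul_pow,
          ← hs1def]
        nlinarith
      -- Cauchy–Schwarz for the path length, one step at a time: the first step satisfies `A² ≤
      -- 2ηa`, the remaining ones `B² ≤ 2nηc`, and `(A + B)² ≤ 2(n+1)η(a + c)` is needed.
      have htri : ‖o - s‖ ≤ ‖o - s1‖ + ‖s1 - s‖ := norm_sub_le_norm_sub_add_norm_sub _ _ _
      have hn : (0 : ℝ) ≤ n := n.cast_nonneg
      have hsq : ‖o - s‖ ^ 2 ≤ (‖o - s1‖ + ‖s1 - s‖) ^ 2 := by gcongr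
      push_cast
      refine hsq.trans ?_
      set A := ‖s1 - s‖
      set B := ‖o - s1‖
      set a := φ s - φ s1 with hadef
      set c := φ s1 - φ o with hcdef
      have hac : φ s - φ o = a + c := by rw [hadef, hcdef]; ring
      have hc : 0 ≤ c := by rw [hcdef]; linarith
      rw [hac]
      -- `2 A B ≤ n A² + B² / n`
      have hAB : 2 * (B * A) ≤ 2 * n * η * a + 2 * η * c := by
        have h3 : (B * A) ^ 2 ≤ (2 * n * η * c) * (2 * η * a) := by
          rw [mul_pow]
          gcongr
        have h4 : (2 * (B * A)) ^ 2 ≤ (2 * n * η * a + 2 * η * c) ^ 2 := by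
          nlinarith [sq_nonneg (2 * n * η * a - 2 * η * c)]
        exact le_of_sq_le_sq h4 (by positivity)
      nlinarith

/-- A gradient step at a point with large gradient decreases the function. -/
lemma GradLipschitz.large_gradient (hφ : ContDiff ℝ 2 φ) (h : GradLipschitz φ b ℓ)
    (hη : 0 < η) (hℓ : 0 ≤ ℓ) (hηℓ : η * ℓ ≤ 1) {ε : ℝ} (hε : 0 ≤ ε) (hb : 0 < b)
    (hεb : ENNReal.ofReal (η * ε) ≤ b) (hg : ε < ‖gradient φ 0‖) :
    φ (PRGD.tangentSpaceSteps (gradient φ) η b 1 0).1 ≤ φ 0 - η * ε ^ 2 / 2 := by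
  have h0 : ‖(0 : V)‖ₑ < b := by simpa using hb
  by_cases hb' : b ≤ ‖0 - η • gradient φ 0‖ₑ
  · simp only [PRGD.tangentSpaceSteps, if_pos hb']
    obtain ⟨hα0, hα1, hαb⟩ := exitFraction_spec h0 hb'
    set α := exitFraction b 0 (η • gradient φ 0)
    rw [← mul_smul] at hαb
    have hαη : 0 < α * η := mul_pos hα0 hη
    have hle : α * η ≤ η := mul_le_of_le_one_left hη.le hα1
    have hstep := h.apply_step_le hφ hαη.le ((mul_le_mul_of_nonneg_right hle hℓ).trans hηℓ)
      h0.le hαb.le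
    -- A truncated step has length `αη‖∇φ(0)‖ = b ≥ ηε`, so it decreases `φ` enough however small
    -- `α` is.
    rw [← hαb, ← ofReal_norm, ENNReal.ofReal_le_ofReal_iff (norm_nonneg _), zero_sub, norm_neg,
      norm_smul, Real.norm_of_nonneg hαη.le] at hεb
    have := mul_le_mul hεb hg.le hε (by positivity)
    linarith
  · simp only [PRGD.tangentSpaceSteps, if_neg hb']
    have hstep := h.apply_step_le hφ hη.le hηℓ h0.le (not_le.1 hb').le
    have : ε ^ 2 ≤ ‖gradient φ 0‖ ^ 2 := by gcongr
    nlinarith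

/-- A small perturbation of a point with small gradient increases the function only slightly. -/
lemma GradLipschitz.apply_perturbation_le (hφ : ContDiff ℝ 2 φ) (h : GradLipschitz φ b ℓ)
    (hℓ : 0 ≤ ℓ) {ε q : ℝ} (hε : 0 ≤ ε)
    (hg : ‖gradient φ 0‖ ≤ ε) {s : V} (hs : ‖s‖ₑ ≤ b) (hsq : ‖s‖ ≤ q) :
    φ s ≤ φ 0 + ε * q + ℓ / 2 * q ^ 2 := by
  have h1 := h.apply_add_le hφ (s := 0) (v := s) (by simp) (by simpa using hs)
  rw [zero_add] at h1
  have h2 := real_inner_le_norm (gradient φ 0) s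
  have h3 : ‖gradient φ 0‖ * ‖s‖ ≤ ε * q := by gcongr
  have h4 : ℓ / 2 * ‖s‖ ^ 2 ≤ ℓ / 2 * q ^ 2 := by gcongr
  linarith

/-- A run that does not decrease the function by much follows the gradient steps, all of which stay
in a small ball. -/
lemma GradLipschitz.norm_iterate_le (hφ : ContDiff ℝ 2 φ) (h : GradLipschitz φ b ℓ)
    (hη : 0 < η) (hℓ : 0 ≤ ℓ) (hηℓ : η * ℓ ≤ 1) {n : ℕ} {s : V} {q D R : ℝ} (hsq : ‖s‖ ≤ q)
    (hD : φ s - φ (PRGD.tangentSpaceSteps (gradient φ) η b n s).1 ≤ D) (hR : q < R)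
    (hDR : 2 * n * η * D ≤ (R - q) ^ 2) (hRb : ENNReal.ofReal R < b) {j : ℕ} (hj : j ≤ n) :
    ‖(gradStep (gradient φ) η)^[j] s‖ ≤ R := by
  have hq0 : 0 ≤ q := (norm_nonneg s).trans hsq
  have hs : ‖s‖ₑ < b := (enorm_le_of_norm_le le_rfl (hsq.trans hR.le)).trans_lt hRb
  have key : ∀ m ≤ n, φ s - φ (PRGD.tangentSpaceSteps (gradient φ) η b m s).1 ≤ D →
      ‖(PRGD.tangentSpaceSteps (gradient φ) η b m s).1‖ ≤ R := by
    intro m hm hmD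
    obtain ⟨h1, h2⟩ := h.tangentSpaceSteps hφ hη hℓ hηℓ m hs
    set o := (PRGD.tangentSpaceSteps (gradient φ) η b m s).1
    have h3 : ‖o - s‖ ^ 2 ≤ (R - q) ^ 2 := by
      refine h2.trans (le_trans ?_ hDR)
      have : (m : ℝ) ≤ n := by exact_mod_cast hm
      have : 0 ≤ φ s - φ o := by linarith
      gcongr
    have h4 : ‖o - s‖ ≤ R - q := le_of_sq_le_sq h3 (by linarith)
    have h5 := norm_le_norm_add_norm_sub' o s
    linarith
  -- If the run stays inside, values fall along it, so its first `j` steps also decrease `φ` by at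
  -- most `D` and `key` applies at `j`. If it exits, it ends at norm `b > R`, which contradicts
  -- `key` at `n`.
  rcases tangentSpaceSteps_eq_or (G := gradient φ) (η := η) n hs with h' | h'
  · have hmono : φ ((gradStep (gradient φ) η)^[n] s) ≤ φ ((gradStep (gradient φ) η)^[j] s) := by
      have aux : ∀ k, j + k ≤ n → φ ((gradStep (gradient φ) η)^[j + k] s) ≤
          φ ((gradStep (gradient φ) η)^[j] s) := by
        intro k
        induction k with
        | zero => simp
        | succ k ih =>
          intro hk
          refine le_trans ?_ (ih (by omega))
          rw [← add_assoc, Function.iterate_succ_apply']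
          have h1 := (h' (j + k) (by omega)).1
          have h2 := (h' (j + k + 1) (by omega)).1
          rw [Function.iterate_succ_apply'] at h2
          have h3 := h.apply_step_le hφ hη.le hηℓ h1.le h2.le
          refine h3.trans (sub_le_self _ (by positivity))
      obtain ⟨k, rfl⟩ := Nat.exists_eq_add_of_le hj
      exact aux k le_rfl
    have h1 := (h' j hj).2
    have h2 := (h' n le_rfl).2
    have := key j hj (by rw [h1]; rw [h2] at hD; dsimp only at hD ⊢; linarith)
    rwa [h1] at this
  · have := key n le_rfl hD
    exact absurd (enorm_le_of_norm_le le_rfl this) (by rw [h']; exact hRb.not_ge)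

lemma continuous_iterate_gradStep (hφ : ContDiff ℝ 2 φ) (j : ℕ) :
    Continuous ((gradStep (gradient φ) η)^[j]) := by
  refine Continuous.iterate ?_ j
  have := (differentiable_gradient hφ).continuous
  unfold gradStep
  fun_prop

end Steps

/-! ## Thin sets in a ball -/

section ThinSets

open MeasureTheory Module

variable {V : Type*} [NormedAddCommGroup V] [InnerProductSpace ℝ V] [FiniteDimensional ℝ V]
  [MeasurableSpace V] [BorelSpace V]

/-- A measurable subset of a ball whose intersections with the lines in one direction are short has
many disjoint translates in a slightly larger ball. -/
lemma nsmul_volume_le_of_thin {A : Set V} (hA : MeasurableSet A) {r w : ℝ} (hw : 0 ≤ w)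
    (hAr : A ⊆ Metric.closedBall 0 r) {e : V} (he : ‖e‖ = 1)
    (hthin : ∀ x ∈ A, ∀ u : ℝ, x + u • e ∈ A → |u| < w) (K : ℕ) :
    (K : ℝ≥0∞) * volume A ≤ volume (Metric.closedBall (0 : V) (r + K * w)) := by
  set B : ℕ → Set V := fun k => (fun x => x + (k * w : ℝ) • e) ⁻¹' A
  have hBm : ∀ k, MeasurableSet (B k) := fun k => hA.preimage (measurable_add_const _)
  have hBv : ∀ k, volume (B k) = volume A := fun k => measure_preimage_add_right _ _ _
  have hdisj : Pairwise (Function.onFun Disjoint B) := by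
    intro i j hij
    refine Set.disjoint_left.2 fun x hi hj => ?_
    have h1 := hthin _ hi ((j * w : ℝ) - i * w) (by
      have : x + (i * w : ℝ) • e + ((j * w : ℝ) - i * w) • e = x + (j * w : ℝ) • e := by module
      rw [this]; exact hj)
    rw [← sub_mul, abs_mul, abs_of_nonneg hw] at h1
    have h2 : (1 : ℝ) ≤ |(j : ℝ) - i| := by
      have : (1 : ℤ) ≤ |(j : ℤ) - i| := Int.one_le_abs (by omega)
      exact_mod_cast this
    nlinarith
  have hsub : (⋃ k ∈ Finset.range K, B k) ⊆ Metric.closedBall (0 : V) (r + K * w) := by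
    intro x hx
    simp only [Finset.mem_range, Set.mem_iUnion] at hx
    obtain ⟨k, hk, hx⟩ := hx
    have h1 : ‖x + (k * w : ℝ) • e‖ ≤ r := mem_closedBall_zero_iff.1 (hAr hx)
    rw [mem_closedBall_zero_iff]
    have h2 : ‖x‖ ≤ ‖x + (k * w : ℝ) • e‖ + ‖(k * w : ℝ) • e‖ := by
      simpa using norm_sub_le (x + (k * w : ℝ) • e) ((k * w : ℝ) • e)
    rw [norm_smul, he, mul_one, Real.norm_of_nonneg (by positivity)] at h2
    have h3 : (k : ℝ) * w ≤ K * w := by gcongr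
    linarith
  calc (K : ℝ≥0∞) * volume A = ∑ k ∈ Finset.range K, volume (B k) := by simp [hBv]
    _ = volume (⋃ k ∈ Finset.range K, B k) :=
        (measure_biUnion_finset (fun i _ j _ hij => hdisj hij) fun k _ => hBm k).symm
    _ ≤ _ := measure_mono hsub

/-- With `K = ⌊r/(wd)⌋` disjoint translates, the ball grows at most by the factor `1 + 1/d` in
radius, hence by `e ≤ 3` in volume. So the probability is at most `3/K`, and `K ≥ r/(2wd)`. When `r
< wd` the claimed bound exceeds `1`. -/
lemma cond_closedBall_le_of_thin [Nontrivial V] {A : Set V} (hA : MeasurableSet A) {r w : ℝ}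
    (hr : 0 < r) (hw : 0 < w) {e : V} (he : ‖e‖ = 1)
    (hthin : ∀ x ∈ A, ‖x‖ ≤ r → ∀ u : ℝ, ‖x + u • e‖ ≤ r → x + u • e ∈ A → |u| < w) :
    ProbabilityTheory.cond volume (Metric.closedBall (0 : V) r) A ≤
      ENNReal.ofReal (6 * w * finrank ℝ V / r) := by
  set d := finrank ℝ V
  have hd : (1 : ℝ) ≤ d := by exact_mod_cast (finrank_pos : 0 < finrank ℝ V)
  set c := Metric.closedBall (0 : V) r with hcdef
  have hc0 : volume c ≠ 0 := (Metric.measure_closedBall_pos _ _ hr).ne'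
  have hct : volume c ≠ ⊤ := measure_closedBall_lt_top.ne
  have hprob : ProbabilityTheory.cond volume c A ≤ 1 := by
    have := ProbabilityTheory.cond_isProbabilityMeasure_of_finite (μ := volume) hc0 hct
    exact prob_le_one
  rcases lt_or_ge r (w * d) with hlt | hge
  · refine hprob.trans ?_
    rw [ENNReal.one_le_ofReal, le_div_iff₀ hr]
    nlinarith
  set K := ⌊r / (w * d)⌋₊
  have hwd : 0 < w * d := by positivity
  have hx1 : 1 ≤ r / (w * d) := by rwa [le_div_iff₀ hwd, one_mul]
  have hK1 : 1 ≤ K := Nat.le_floor (by simpa using hx1)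
  have hK1' : (1 : ℝ) ≤ K := by exact_mod_cast hK1
  have hKle : K * (w * d) ≤ r := by
    rw [← le_div_iff₀ hwd]
    exact Nat.floor_le (by positivity)
  have hKge : r / (w * d) ≤ 2 * K := by
    have := Nat.lt_floor_add_one (r / (w * d))
    change _ < (K : ℝ) + 1 at this
    linarith
  have hvol := nsmul_volume_le_of_thin (A := c ∩ A) (measurableSet_closedBall.inter hA) hw.le
    Set.inter_subset_left he (fun x hx u hu => hthin x hx.2 (mem_closedBall_zero_iff.1 hx.1) u
      (mem_closedBall_zero_iff.1 hu.1) hu.2) K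
  have hscale : volume (Metric.closedBall (0 : V) (r + K * w)) ≤ ENNReal.ofReal 3 * volume c := by
    have h1 : r + K * w = (1 + K * w / r) * r := by field_simp
    rw [h1, Measure.addHaar_closedBall_mul _ _ (by positivity) hr.le]
    refine mul_le_mul_left (ENNReal.ofReal_le_ofReal ?_) _
    have h2 : K * w / r ≤ 1 / d := by
      rw [div_le_div_iff₀ hr (by positivity)]
      linarith
    calc (1 + K * w / r) ^ d ≤ (Real.exp (1 / d)) ^ d := by
          gcongr
          have := Real.add_one_le_exp (1 / (d : ℝ))
          linarith
      _ = Real.exp 1 := by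
          rw [← Real.exp_nat_mul]
          congr 1
          field_simp
      _ ≤ 3 := by linarith [Real.exp_one_lt_d9]
  rw [ProbabilityTheory.cond_apply measurableSet_closedBall]
  have hfin := hvol.trans hscale
  have hK0 : (K : ℝ≥0∞) ≠ 0 := by exact_mod_cast (by omega : K ≠ 0)
  calc (volume c)⁻¹ * volume (c ∩ A)
      = (K : ℝ≥0∞)⁻¹ * ((volume c)⁻¹ * (K * volume (c ∩ A))) := by
        rw [mul_left_comm (volume c)⁻¹, ← mul_assoc (K : ℝ≥0∞)⁻¹,
          ENNReal.inv_mul_cancel hK0 (ENNReal.natCast_ne_top K), one_mul]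
    _ ≤ (K : ℝ≥0∞)⁻¹ * ((volume c)⁻¹ * (ENNReal.ofReal 3 * volume c)) := by gcongr
    _ = (K : ℝ≥0∞)⁻¹ * ENNReal.ofReal 3 := by
        rw [mul_left_comm (volume c)⁻¹, ENNReal.inv_mul_cancel hc0 hct, mul_one]
    _ = ENNReal.ofReal ((K : ℝ)⁻¹ * 3) := by
        rw [ENNReal.ofReal_mul (by positivity), ENNReal.ofReal_inv_of_pos (by positivity),
          ENNReal.ofReal_natCast]
    _ ≤ ENNReal.ofReal (6 * w * d / r) := by
        refine ENNReal.ofReal_le_ofReal ?_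
        rw [div_le_iff₀ hwd] at hKge
        rw [inv_mul_eq_div, div_le_div_iff₀ (by positivity) hr]
        linarith

end ThinSets

/-! ## Escape from saddle points -/

section Saddle

variable {V : Type*} [NormedAddCommGroup V] [InnerProductSpace ℝ V] [FiniteDimensional ℝ V]
  [CompleteSpace V] {φ : V → ℝ} {b : ℝ≥0∞} {ρ η : ℝ}

/-- Two runs of gradient descent whose starting points differ by a multiple of the lowest
eigenvector of the Hessian separate exponentially fast, as long as they stay close to the
origin. -/
lemma HessBound.pow_mul_abs_le (hφ : ContDiff ℝ 2 φ) (hρ : 0 ≤ ρ) (h : HessBound φ b ρ)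
    (hη : 0 ≤ η) (hηA : η * ‖hessian φ 0‖ ≤ 1) {e : V} (he : ‖e‖ = 1)
    (hAe : hessian φ 0 e = lambdaMin (hessian φ 0) • e) (hlam : lambdaMin (hessian φ 0) ≤ 0)
    {R : ℝ} (hR : 0 ≤ R) (hRb : ENNReal.ofReal R ≤ b) {n : ℕ} (hn : 3 * (η * ρ * R) * n ≤ 1)
    {s : V} {τ : ℝ}
    (hs : ∀ j ≤ n, ‖(gradStep (gradient φ) η)^[j] s‖ ≤ R)
    (hs' : ∀ j ≤ n, ‖(gradStep (gradient φ) η)^[j] (s + τ • e)‖ ≤ R) :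
    (1 - η * lambdaMin (hessian φ 0)) ^ n * |τ| ≤ 4 * R := by
  set A := hessian φ 0
  set β := 1 - η * lambdaMin A with hβdef
  have hβ : 1 ≤ β := by rw [hβdef]; nlinarith
  set x : ℕ → V := fun j => (gradStep (gradient φ) η)^[j] s
  set y : ℕ → V := fun j => (gradStep (gradient φ) η)^[j] (s + τ • e)
  -- The difference of the runs is `β^j τ e` plus an error `q`. As `3ηρRn ≤ 1`, the bound on `q`
  -- stays below half of the main term. Then the difference is at most `3/2` of the main term, and
  -- one step adds at most `ηρR` times that to the error.
  have hdist : ∀ j ≤ n, ‖y j - x j - (β ^ j * τ) • e‖ ≤ 3 / 2 * (η * ρ * R) * j * (β ^ j * |τ|) := by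
    intro j
    induction j with
    | zero => intro _; simp [x, y]
    | succ j ih =>
      intro hj
      have hj' := ih (by omega)
      set q := y j - x j - (β ^ j * τ) • e with hq
      set err := gradient φ (y j) - gradient φ (x j) - A (y j - x j) with herr
      have herr_le : ‖err‖ ≤ ρ * R * ‖y j - x j‖ :=
        h.norm_gradient_sub_sub_le hφ hρ hRb (hs' j (by omega)) (hs j (by omega))
      have hz : ‖y j - x j‖ ≤ 3 / 2 * (β ^ j * |τ|) := by
        have h1 : y j - x j = q + (β ^ j * τ) • e := by rw [hq]; abel
        have h2 : ‖(β ^ j * τ) • e‖ = β ^ j * |τ| := by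
          rw [norm_smul, he, mul_one, norm_mul, Real.norm_of_nonneg (by positivity),
            Real.norm_eq_abs]
        have h3 : 3 / 2 * (η * ρ * R) * j ≤ 1 / 2 := by
          have : (j : ℝ) ≤ n := by exact_mod_cast (by omega : j ≤ n)
          have : 3 * (η * ρ * R) * j ≤ 3 * (η * ρ * R) * n := by gcongr
          linarith
        have h4 : 3 / 2 * (η * ρ * R) * j * (β ^ j * |τ|) ≤ 1 / 2 * (β ^ j * |τ|) := by gcongr
        rw [h1]
        refine (norm_add_le _ _).trans ?_
        rw [h2]
        linarith
      have hrec : y (j + 1) - x (j + 1) - (β ^ (j + 1) * τ) • e = (q - η • A q) - η • err := by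
        have hx1 : x (j + 1) = x j - η • gradient φ (x j) := Function.iterate_succ_apply' _ _ _
        have hy1 : y (j + 1) = y j - η • gradient φ (y j) := Function.iterate_succ_apply' _ _ _
        have hAq : A q = A (y j - x j) - (β ^ j * τ) • lambdaMin A • e := by
          rw [hq, map_sub, map_smul, hAe]
        have hp : β ^ (j + 1) * τ = β ^ j * τ - η * (β ^ j * τ * lambdaMin A) := by
          rw [pow_succ, hβdef]; ring
        rw [hx1, hy1, hAq, hp, herr, hq]
        module
      rw [hrec]
      have h5 : ‖q - η • A q‖ ≤ β * ‖q‖ := by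
        have := norm_sub_smul_apply_le (isSymmetric_hessian hφ 0) hη hηA q
        rwa [← hβdef, abs_of_nonneg (by linarith)] at this
      have h6 : ‖η • err‖ ≤ η * (ρ * R * (3 / 2 * (β ^ j * |τ|))) := by
        rw [norm_smul, Real.norm_of_nonneg hη]
        gcongr
        exact herr_le.trans (by gcongr)
      have h7 : η * (ρ * R * (3 / 2 * (β ^ j * |τ|))) ≤
          3 / 2 * (η * ρ * R) * (β ^ (j + 1) * |τ|) := by
        have : β ^ j ≤ β ^ (j + 1) := pow_le_pow_right₀ hβ (by omega)
        calc _ = 3 / 2 * (η * ρ * R) * (β ^ j * |τ|) := by ring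
          _ ≤ _ := by gcongr
      have h8 : β * ‖q‖ ≤ β * (3 / 2 * (η * ρ * R) * j * (β ^ j * |τ|)) := by gcongr
      refine (norm_sub_le _ _).trans ((add_le_add h5 h6).trans ?_)
      refine (add_le_add h8 h7).trans (le_of_eq ?_)
      push_cast
      ring
  have h1 := hdist n le_rfl
  have h2 : ‖(β ^ n * τ) • e‖ = β ^ n * |τ| := by
    rw [norm_smul, he, mul_one, norm_mul, Real.norm_of_nonneg (by positivity), Real.norm_eq_abs]
  have h3 : ‖(β ^ n * τ) • e‖ ≤ ‖y n - x n‖ + ‖y n - x n - (β ^ n * τ) • e‖ := by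
    simpa using norm_sub_le (y n - x n) (y n - x n - (β ^ n * τ) • e)
  have h4 : ‖y n - x n‖ ≤ R + R := (norm_sub_le _ _).trans (add_le_add (hs' n le_rfl) (hs n le_rfl))
  have h5 : 3 / 2 * (η * ρ * R) * n * (β ^ n * |τ|) ≤ 1 / 2 * (β ^ n * |τ|) := by
    gcongr
    linarith
  linarith

/-- With high probability, a run that starts near a strict saddle point decreases the function. -/
lemma uniformBall_setOf_not_decrease_le [Nontrivial V] {ℓ : ℝ} (hφ : ContDiff ℝ 2 φ)
    (hρ : 0 ≤ ρ) (hH : HessBound φ b ρ) (hG : GradLipschitz φ b ℓ) (hη : 0 < η) (hℓ : 0 ≤ ℓ)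
    (hηℓ : η * ℓ ≤ 1) (hA : ‖hessian φ 0‖ ≤ ℓ) (hlam : lambdaMin (hessian φ 0) ≤ 0)
    {n : ℕ} {r w F D R : ℝ} (hr : 0 < r) (hw : 0 < w) (hR : η * r < R)
    (hRb : ENNReal.ofReal R < b) (hn : 3 * (η * ρ * R) * n ≤ 1)
    (hinc : ∀ s : V, ‖s‖ ≤ η * r → φ s + F ≤ φ 0 + D)
    (hDR : 2 * n * η * D ≤ (R - η * r) ^ 2)
    (hwR : 4 * R < (1 - η * lambdaMin (hessian φ 0)) ^ n * (η * w)) :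
    uniformBall V r {ξ | ‖ξ‖ ≤ r ∧
      φ 0 - F < φ (tangentSpaceSteps (gradient φ) η b n (η • ξ)).1} ≤
      ENNReal.ofReal (6 * w * Module.finrank ℝ V / r) := by
  let : MeasurableSpace V := borel V
  have : BorelSpace V := ⟨rfl⟩
  have hR0 : 0 ≤ R := le_trans (by positivity) hR.le
  -- A closed superset of the bad set, defined by the unstopped gradient iterates; measurability of
  -- the stopped run is never needed.
  set A : Set V := ⋂ j ∈ Finset.range (n + 1), {ξ | ‖(gradStep (gradient φ) η)^[j] (η • ξ)‖ ≤ R}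
    with hAdef
  have hmem : ∀ ξ, ξ ∈ A ↔ ∀ j ≤ n, ‖(gradStep (gradient φ) η)^[j] (η • ξ)‖ ≤ R := by
    intro ξ
    simp [hAdef]
  have hAm : MeasurableSet A := by
    refine Finset.measurableSet_biInter _ fun j _ => IsClosed.measurableSet ?_
    exact isClosed_le (((continuous_iterate_gradStep hφ j).comp
      (continuous_const_smul η)).norm) continuous_const
  obtain ⟨e, he, hAe⟩ := exists_eigenvector_lambdaMin (isSymmetric_hessian hφ 0)
  have hηA : η * ‖hessian φ 0‖ ≤ 1 := (mul_le_mul_of_nonneg_left hA hη.le).trans hηℓ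
  set β := (1 - η * lambdaMin (hessian φ 0)) ^ n
  have hβ : 0 < β := pow_pos (by nlinarith) n
  have hthin : ∀ x ∈ A, ‖x‖ ≤ r → ∀ u : ℝ, ‖x + u • e‖ ≤ r → x + u • e ∈ A → |u| < w := by
    intro x hx _ u _ hxu
    have h1 := hH.pow_mul_abs_le hφ hρ hη.le hηA he hAe hlam hR0 hRb.le hn (s := η • x)
      (τ := η * u) ((hmem x).1 hx) (by
        have h2 := (hmem _).1 hxu
        rwa [smul_add, smul_smul] at h2)
    rw [abs_mul, abs_of_pos hη] at h1
    have h2 := h1.trans_lt hwR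
    exact lt_of_mul_lt_mul_left (lt_of_mul_lt_mul_left h2 hβ.le) hη.le
  refine le_trans (MeasureTheory.measure_mono fun ξ hξ => ?_)
    (cond_closedBall_le_of_thin hAm hr hw he hthin)
  obtain ⟨hξr, hξ⟩ := hξ
  have hsr : ‖η • ξ‖ ≤ η * r := by
    rw [norm_smul, Real.norm_of_nonneg hη.le]
    gcongr
  refine (hmem ξ).2 fun j hj => ?_
  refine hG.norm_iterate_le hφ hη hℓ hηℓ hsr (D := D) ?_ hR hDR hRb hj
  have := hinc _ hsr
  linarith

end Saddle

/-! ## The main loop -/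

section UniformBall

open MeasureTheory

variable {V : Type*} [NormedAddCommGroup V] [InnerProductSpace ℝ V] [FiniteDimensional ℝ V]

/-- A lower bound for the lower integral of a function that need not be measurable. -/
lemma mul_le_lintegral_uniformBall {r : ℝ} (hr : 0 < r) {E : Set V} {q : ℝ≥0∞}
    (hE : uniformBall V r E ≤ q) {h : V → ℝ≥0∞} {c : ℝ≥0∞}
    (hc : ∀ ξ, ‖ξ‖ ≤ r → ξ ∉ E → c ≤ h ξ) :
    c * (1 - q) ≤ @lintegral V (borel V) (uniformBall V r) h := by
  let : MeasurableSpace V := borel V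
  have : BorelSpace V := ⟨rfl⟩
  set B := Metric.closedBall (0 : V) r
  set μ : Measure V := ProbabilityTheory.cond volume B
  have hμ : uniformBall V r = μ := rfl
  rw [hμ] at hE ⊢
  have hB0 : volume B ≠ 0 := (Metric.measure_closedBall_pos _ _ hr).ne'
  have hBt : volume B ≠ ⊤ := measure_closedBall_lt_top.ne
  have hμB : μ B = 1 := ProbabilityTheory.cond_apply_self hB0 hBt
  -- Neither `E` nor `h` need be measurable: the measurable hull of `E` has the same measure, and
  -- off it `h` is bounded below by a constant.
  set E' := toMeasurable μ E
  have hm : MeasurableSet (B \ E') := measurableSet_closedBall.diff (measurableSet_toMeasurable _ _)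
  calc c * (1 - q) ≤ c * μ (B \ E') := by
        gcongr
        calc 1 - q ≤ μ B - μ E' := by
              rw [hμB, measure_toMeasurable]
              exact tsub_le_tsub_left hE 1
          _ ≤ μ (B \ E') := le_measure_sdiff
    _ = ∫⁻ _ in B \ E', c ∂μ := by rw [setLIntegral_const]
    _ ≤ ∫⁻ ξ in B \ E', h ξ ∂μ := setLIntegral_mono' hm fun ξ hξ =>
        hc ξ (mem_closedBall_zero_iff.1 hξ.1) fun hE => hξ.2 (subset_toMeasurable _ _ hE)
    _ ≤ ∫⁻ ξ, h ξ ∂μ := setLIntegral_le_lintegral _ _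

end UniformBall

section Loop

variable {M : Type*} {V : M → Type*} [∀ x, NormedAddCommGroup (V x)]

open Classical in
/-- Number of processed iterates with small gradient. -/
def smallCount (g : ∀ x, V x) (ε : ℝ) (S : State M) : ℕ :=
  S.visited.countP fun x => decide (‖g x‖ ≤ ε)

open Classical in
/-- Number of processed iterates with small gradient that satisfy `Q`. -/
def goodCount (g : ∀ x, V x) (ε : ℝ) (Q : M → Prop) (S : State M) : ℕ :=
  S.visited.countP fun x => decide (‖g x‖ ≤ ε ∧ Q x)

lemma goodCount_le_smallCount (g : ∀ x, V x) (ε : ℝ) (Q : M → Prop) (S : State M) :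
    goodCount g ε Q S ≤ smallCount g ε S :=
  List.countP_mono_left fun x _ h => by simp_all

lemma smallCount_le_length (g : ∀ x, V x) (ε : ℝ) (S : State M) :
    smallCount g ε S ≤ S.visited.length :=
  List.countP_le_length

/-- Accounting of time, queries and function values at the head of the loop: a round with large
gradient decreases `f` by `a`; a round with small gradient increases it by at most `c` where `Q`
holds and decreases it by `F` elsewhere. -/
structure Accounting (p : Params) (g : ∀ x, V x) (f : M → ℝ) (Q : M → Prop) (a c F : ℝ) (x₀ : M)
    (S : State M) : Prop where
  time_eq : S.time + smallCount g p.ε S = S.visited.length + p.𝒯 * smallCount g p.ε S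
  time_le : (S.time : ℝ) ≤ p.T + p.𝒯
  queries_le : S.stepQueries ≤ S.time
  value_le : f S.point + (S.visited.length - smallCount g p.ε S) * a +
    (smallCount g p.ε S - goodCount g p.ε Q S) * F ≤ f x₀ + goodCount g p.ε Q S * c

variable {p : Params} {g : ∀ x, V x} {G : ∀ x, V x → V x} {R : ∀ x, V x → M} {f : M → ℝ}
  {Q : M → Prop} {a c F : ℝ} {x₀ : M} {S : State M}

lemma Accounting.init (hT : 0 ≤ p.T) : Accounting p g f Q a c F x₀ (State.init x₀) where
  time_eq := by simp [State.init, smallCount]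
  time_le := by simp only [State.init, Nat.cast_zero]; positivity
  queries_le := le_rfl
  value_le := by simp [State.init, smallCount, goodCount]

variable [∀ x, InnerProductSpace ℝ (V x)]

lemma Accounting.move_large (h : Accounting p g f Q a c F x₀ S) (h𝒯 : 1 ≤ p.𝒯)
    (hT : (S.time : ℝ) ≤ p.T) (hg : p.ε < ‖g S.point‖)
    (hf : f (R S.point (tangentSpaceSteps (G S.point) p.η p.b 1 0).1) ≤ f S.point - a) :
    Accounting p g f Q a c F x₀ (S.move p G R 1 0) := by
  have h1 : smallCount g p.ε (S.move p G R 1 0) = smallCount g p.ε S := by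
    simp [smallCount, State.move, List.countP_append, hg]
  have h2 : goodCount g p.ε Q (S.move p G R 1 0) = goodCount g p.ε Q S := by
    simp [goodCount, State.move, List.countP_append, hg.not_ge]
  have h3 : (S.move p G R 1 0).visited.length = S.visited.length + 1 := by simp [State.move]
  refine ⟨?_, ?_, ?_, ?_⟩
  · rw [h1, h3]
    have := h.time_eq
    simp only [State.move]
    omega
  · have : (1 : ℝ) ≤ p.𝒯 := by exact_mod_cast h𝒯
    simp only [State.move]
    push_cast
    linarith
  · exact add_le_add h.queries_le (tangentSpaceSteps_queries_le _ _ _ _ _)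
  · rw [h1, h2, h3]
    have := h.value_le
    simp only [State.move]
    push_cast
    linarith

lemma Accounting.move_small (h : Accounting p g f Q a c F x₀ S)
    (hT : (S.time : ℝ) ≤ p.T) (hg : ‖g S.point‖ ≤ p.ε) {s : V S.point}
    (hfc : Q S.point →
      f (R S.point (tangentSpaceSteps (G S.point) p.η p.b p.𝒯 s).1) ≤ f S.point + c)
    (hfF : ¬ Q S.point →
      f (R S.point (tangentSpaceSteps (G S.point) p.η p.b p.𝒯 s).1) ≤ f S.point - F) :
    Accounting p g f Q a c F x₀ (S.move p G R p.𝒯 s) := by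
  have h1 : smallCount g p.ε (S.move p G R p.𝒯 s) = smallCount g p.ε S + 1 := by
    simp [smallCount, State.move, List.countP_append, hg]
  have h3 : (S.move p G R p.𝒯 s).visited.length = S.visited.length + 1 := by simp [State.move]
  refine ⟨?_, ?_, ?_, ?_⟩
  · rw [h1, h3]
    have := h.time_eq
    simp only [State.move]
    linarith
  · simp only [State.move]
    push_cast
    linarith
  · exact add_le_add h.queries_le (tangentSpaceSteps_queries_le _ _ _ _ _)
  · have := h.value_le
    rw [h1, h3]
    by_cases hQ : Q S.point
    · have h2 : goodCount g p.ε Q (S.move p G R p.𝒯 s) = goodCount g p.ε Q S + 1 := by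
        simp [goodCount, State.move, List.countP_append, hg, hQ]
      rw [h2]
      have := hfc hQ
      simp only [State.move]
      push_cast
      linarith
    · have h2 : goodCount g p.ε Q (S.move p G R p.𝒯 s) = goodCount g p.ε Q S := by
        simp [goodCount, State.move, List.countP_append, hQ]
      rw [h2]
      have := hfF hQ
      simp only [State.move]
      push_cast
      linarith

/-- Every round advances the counter by at least `1`, so `p.T < S.time + k` survives the recursion;
when the fuel is used up it says that the loop has ended. -/
lemma Accounting.exec (h𝒯 : 1 ≤ p.𝒯)
    (hlarge : ∀ x, p.ε < ‖g x‖ →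
      f (R x (tangentSpaceSteps (G x) p.η p.b 1 0).1) ≤ f x - a)
    (hsmall : ∀ x, ‖g x‖ ≤ p.ε → Q x → ∀ ξ : V x, ‖ξ‖ ≤ p.r →
      f (R x (tangentSpaceSteps (G x) p.η p.b p.𝒯 (p.η • ξ)).1) ≤ f x + c)
    (hsaddle : ∀ x, ‖g x‖ ≤ p.ε → ¬ Q x → ∀ ξ : V x, ‖ξ‖ ≤ p.r →
      f (R x (tangentSpaceSteps (G x) p.η p.b p.𝒯 (p.η • ξ)).1) ≤ f x - F)
    {ζ : ℕ → ∀ x, V x} (hζ : ∀ k x, ‖ζ k x‖ ≤ p.r) (k : ℕ)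
    (h : Accounting p g f Q a c F x₀ S) (hk : p.T < S.time + k) :
    Accounting p g f Q a c F x₀ (PRGD.exec p g G R ζ k S) ∧
      p.T < (PRGD.exec p g G R ζ k S).time := by
  induction k generalizing S with
  | zero => exact ⟨h, by simpa [PRGD.exec] using hk⟩
  | succ k ih =>
    have h𝒯' : (1 : ℝ) ≤ p.𝒯 := by exact_mod_cast h𝒯
    push_cast at hk
    simp only [PRGD.exec]
    split_ifs with hT hg
    · refine ih (h.move_large h𝒯 hT hg (hlarge _ hg)) ?_
      simp only [State.move]
      push_cast
      linarith
    · have hg' := not_lt.1 hg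
      refine ih (h.move_small hT hg' (fun hQ => hsmall _ hg' hQ _ (hζ _ _))
        (fun hQ => hsaddle _ hg' hQ _ (hζ _ _))) ?_
      simp only [State.move]
      push_cast
      linarith
    · exact ⟨h, not_le.1 hT⟩

/-- The union bound along the recursion. Here `m` bounds the number of perturbations still to come,
because each one advances the counter by `𝒯`. Each costs a factor `1 - q`, and `(1 - mq)(1 - q) ≥ 1
- (m+1)q`. -/
lemma Accounting.le_expect [∀ x, FiniteDimensional ℝ (V x)] (h𝒯 : 1 ≤ p.𝒯) (hr : 0 < p.r)
    (hlarge : ∀ x, p.ε < ‖g x‖ →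
      f (R x (tangentSpaceSteps (G x) p.η p.b 1 0).1) ≤ f x - a)
    (hsmall : ∀ x, ‖g x‖ ≤ p.ε → Q x → ∀ ξ : V x, ‖ξ‖ ≤ p.r →
      f (R x (tangentSpaceSteps (G x) p.η p.b p.𝒯 (p.η • ξ)).1) ≤ f x + c)
    {q : ℝ} (hq : 0 ≤ q)
    (hsaddle : ∀ x, ‖g x‖ ≤ p.ε → ¬ Q x → uniformBall (V x) p.r {ξ | ‖ξ‖ ≤ p.r ∧
      f x - F < f (R x (tangentSpaceSteps (G x) p.η p.b p.𝒯 (p.η • ξ)).1)} ≤ ENNReal.ofReal q)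
    {ψ : State M → ℝ≥0∞}
    (hψ : ∀ S, Accounting p g f Q a c F x₀ S → p.T < S.time → 1 ≤ ψ S) (k : ℕ) {m : ℕ}
    (h : Accounting p g f Q a c F x₀ S) (hk : p.T < S.time + k) (hm : p.T < S.time + m * p.𝒯) :
    ENNReal.ofReal (1 - m * q) ≤ expect p g G R ψ k S := by
  have hle1 : ∀ m : ℕ, ENNReal.ofReal (1 - m * q) ≤ 1 := fun m =>
    ENNReal.ofReal_le_one.2 (by nlinarith [mul_nonneg m.cast_nonneg hq])
  induction k generalizing S m with
  | zero => exact (hle1 m).trans (hψ S h (by simpa using hk))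
  | succ k ih =>
    have h𝒯' : (1 : ℝ) ≤ p.𝒯 := by exact_mod_cast h𝒯
    push_cast at hk
    simp only [expect]
    split_ifs with hT hg
    · refine ih (h.move_large h𝒯 hT hg (hlarge _ hg)) ?_ ?_ <;>
      · simp only [State.move]
        push_cast
        linarith
    · have hg' := not_lt.1 hg
      obtain ⟨m, rfl⟩ : ∃ m', m = m' + 1 := Nat.exists_eq_succ_of_ne_zero (by
        rintro rfl
        simp only [Nat.cast_zero, zero_mul, add_zero] at hm
        linarith)
      push_cast at hm
      -- Putting `¬ Q` into the bad set makes it empty at second-order points, so one integral bound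
      -- serves both cases.
      have hstep : ∀ ξ : V S.point, ‖ξ‖ ≤ p.r → ξ ∉ {ξ | ‖ξ‖ ≤ p.r ∧ ¬ Q S.point ∧
          f S.point - F < f (R S.point (tangentSpaceSteps (G S.point) p.η p.b p.𝒯 (p.η • ξ)).1)} →
          ENNReal.ofReal (1 - m * q) ≤ expect p g G R ψ k (S.move p G R p.𝒯 (p.η • ξ)) := by
        intro ξ hξ hξE
        refine ih (h.move_small hT hg' (fun hQ => hsmall _ hg' hQ ξ hξ) fun hQ => ?_) ?_ ?_
        · by_contra hcon
          exact hξE ⟨hξ, hQ, not_le.1 hcon⟩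
        all_goals
          simp only [State.move]
          push_cast
          linarith
      refine le_trans ?_ (mul_le_lintegral_uniformBall hr (q := ENNReal.ofReal q) ?_ hstep)
      · rw [← ENNReal.ofReal_one, ← ENNReal.ofReal_sub _ hq]
        by_cases h0 : 1 - m * q ≤ 0
        · rw [ENNReal.ofReal_of_nonpos (by push_cast; linarith)]
          exact zero_le
        rw [← ENNReal.ofReal_mul (not_le.1 h0).le]
        refine ENNReal.ofReal_le_ofReal ?_
        push_cast
        nlinarith [mul_nonneg (mul_nonneg (m.cast_nonneg (α := ℝ)) hq) hq]
      · by_cases hQ : Q S.point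
        · simp [hQ]
        · simpa [hQ] using hsaddle _ hg' hQ
    · exact (hle1 m).trans (hψ S h (not_le.1 hT))

end Loop

/-! ## Pullbacks by a retraction -/

section Pullback

variable {d : ℕ} {M : Type*} [TopologicalSpace M] [ChartedSpace (EuclideanSpace ℝ (Fin d)) M]

lemma finrank_tangentSpace (x : M) : Module.finrank ℝ (TangentSpace (𝓡 d) x) = d := by
  change Module.finrank ℝ (EuclideanSpace ℝ (Fin d)) = d
  simp

variable [IsManifold (𝓡 d) ∞ M] [Bundle.RiemannianBundle (fun x : M => TangentSpace (𝓡 d) x)]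

/-- In the trivialization at `x` the inclusion of the fibre is a continuous linear equivalence,
hence smooth for the Riemannian norm on the fibre as well. -/
lemma contMDiff_mk_tangentBundle (x : M) :
    ContMDiff 𝓘(ℝ, TangentSpace (𝓡 d) x) (𝓡 d).tangent 2
      (fun s : TangentSpace (𝓡 d) x => (⟨x, s⟩ : TangentBundle (𝓡 d) M)) := by
  intro s
  refine Bundle.contMDiffAt_totalSpace.2 ⟨contMDiffAt_const, ?_⟩
  set e := trivializationAt (EuclideanSpace ℝ (Fin d)) (TangentSpace (𝓡 d) : M → Type _) x
  have hx : x ∈ e.baseSet := FiberBundle.mem_baseSet_trivializationAt' x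
  let A : TangentSpace (𝓡 d) x ≃L[ℝ] EuclideanSpace ℝ (Fin d) := e.continuousLinearEquivAt ℝ x hx
  have hA : ContMDiffAt 𝓘(ℝ, TangentSpace (𝓡 d) x) 𝓘(ℝ, EuclideanSpace ℝ (Fin d)) 2 A s :=
    A.contDiff.contMDiff s
  exact hA

variable {Retr : TangentBundle (𝓡 d) M → M} {f : M → ℝ}

lemma contDiff_pullback (hR : IsRetraction Retr) (hf : ContMDiff (𝓡 d) 𝓘(ℝ, ℝ) 2 f) (x : M) :
    ContDiff ℝ 2 (pullback Retr f x) := by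
  rw [← contMDiff_iff_contDiff]
  exact hf.comp ((hR.smooth.of_le ENat.LEInfty.out).comp (contMDiff_mk_tangentBundle x))

lemma pullback_zero (hR : IsRetraction Retr) (x : M) : pullback Retr f x 0 = f x := by
  simp [pullback, hR.map_zero]

/-- Chain rule with `D Retr_x(0) = Id`: the gradient tested by the loop is the one that drives the
first unperturbed step. -/
lemma gradient_pullback_zero (hR : IsRetraction Retr) (hf : ContMDiff (𝓡 d) 𝓘(ℝ, ℝ) 2 f) (x : M) :
    gradient (pullback Retr f x) 0 = grad f x := by
  have h1 : HasMFDerivAt (𝓡 d) 𝓘(ℝ, ℝ) f x (mfderiv (𝓡 d) 𝓘(ℝ, ℝ) f x) :=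
    (hf.mdifferentiable two_ne_zero x).hasMFDerivAt
  have h2 : HasMFDerivAt 𝓘(ℝ, TangentSpace (𝓡 d) x) 𝓘(ℝ, ℝ) (pullback Retr f x) 0
      (mfderiv (𝓡 d) 𝓘(ℝ, ℝ) f x) := by
    have h3 : HasMFDerivAt (𝓡 d) 𝓘(ℝ, ℝ) f (Retr ⟨x, 0⟩) (mfderiv (𝓡 d) 𝓘(ℝ, ℝ) f x) := by
      rw [hR.map_zero]
      exact h1
    have h5 := HasMFDerivAt.comp (I := 𝓘(ℝ, TangentSpace (𝓡 d) x)) (I' := 𝓡 d) (I'' := 𝓘(ℝ, ℝ))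
      (0 : TangentSpace (𝓡 d) x) h3 (hR.deriv_zero x)
    exact h5
  have h4 : fderiv ℝ (pullback Retr f x) 0 = mfderiv (𝓡 d) 𝓘(ℝ, ℝ) f x :=
    HasFDerivAt.fderiv (E := TangentSpace (𝓡 d) x) (F := ℝ) (hasMFDerivAt_iff_hasFDerivAt.1 h2)
  unfold gradient grad
  rw [h4]

end Pullback

/-! ## Arithmetic of the parameters -/

section Parameters

variable {ℓ ρ ε δ Δ χ σ : ℝ}

/-- In terms of `σ = √(ρε)` the fractional powers disappear here and in the next two lemmas, leaving
rational expressions in `ε`, `σ`, `ℓ`, `Δ`, `χ`, `δ`. -/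
lemma sq_le_of_rpow_le (hρ : 0 < ρ) (hε : 0 < ε) (h : ε ^ (3 / 2 : ℝ) ≤ 3 * √ρ * Δ) :
    ε ^ 2 ≤ 3 * √(ρ * ε) * Δ := by
  have h1 : ε ^ (3 / 2 : ℝ) * √ε = ε ^ 2 := by
    rw [Real.sqrt_eq_rpow, ← Real.rpow_add hε, ← Real.rpow_natCast]
    norm_num
  rw [Real.sqrt_mul hρ.le, ← h1]
  calc ε ^ (3 / 2 : ℝ) * √ε ≤ 3 * √ρ * Δ * √ε := by gcongr
    _ = _ := by ring

lemma kappa_eq (hρ : 0 < ρ) (hε : 0 < ε) :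
    kappa ℓ ρ ε δ Δ = ℓ ^ 2 * Δ / (δ * √(ρ * ε) * ε ^ 2) := by
  have h1 : ε ^ (5 / 2 : ℝ) = √ε * ε ^ 2 := by
    rw [Real.sqrt_eq_rpow, ← Real.rpow_natCast, ← Real.rpow_add hε]
    norm_num
  rw [kappa, h1, Real.sqrt_mul hρ.le]
  ring

lemma decrease_eq (hρ : 0 < ρ) (hε : 0 < ε) :
    decrease ρ ε χ = ε ^ 2 / (50 * χ ^ 3 * √(ρ * ε)) := by
  have h1 : ε ^ 3 / ρ = (ε ^ 2 / √(ρ * ε)) ^ 2 := by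
    rw [div_pow, Real.sq_sqrt (by positivity)]
    field_simp
  rw [decrease, h1, Real.sqrt_sq (by positivity)]
  ring

/-- `σ ≤ ℓ` and `ε² ≤ 3σΔ` give `3κ ≥ 1/δ`. -/
lemma one_lt_three_mul_kappa (hρ : 0 < ρ) (hε : 0 < ε) (hℓ : √(ρ * ε) ≤ ℓ)
    (hΔ : ε ^ 2 ≤ 3 * √(ρ * ε) * Δ) (hδ : 0 < δ) (hδ1 : δ < 1) :
    1 < 3 * kappa ℓ ρ ε δ Δ := by
  have hσ : 0 < √(ρ * ε) := Real.sqrt_pos.2 (by positivity)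
  rw [kappa_eq hρ hε]
  set σ := √(ρ * ε)
  have hΔ0 : 0 < Δ := by
    by_contra hcon
    have : 3 * σ * Δ ≤ 0 := mul_nonpos_of_nonneg_of_nonpos (by positivity) (not_lt.1 hcon)
    nlinarith [pow_pos hε 2]
  rw [← mul_div_assoc, lt_div_iff₀ (by positivity), one_mul]
  have h1 : σ ^ 2 * Δ ≤ ℓ ^ 2 * Δ := by gcongr
  have h2 : σ * ε ^ 2 ≤ σ * (3 * σ * Δ) := by gcongr
  have h3 : 0 < σ * ε ^ 2 := by positivity
  nlinarith

/-- The argument of the logarithm exceeds `2^31 / 3 ≥ 2^25`. The numerical estimates below rely on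
this rather than on `χ > 1/4`. -/
lemma Admissible.hundred_le {d : ℕ} {𝒯 : ℕ} (hd : 0 < d) (h : Admissible d ℓ ρ ε δ Δ χ 𝒯)
    (hκ : 1 < 3 * kappa ℓ ρ ε δ Δ) : 100 ≤ χ := by
  have hd1 : (1 : ℝ) ≤ √(d : ℝ) := by
    rw [Real.one_le_sqrt]
    exact_mod_cast hd
  have h1 : (2 : ℝ) ^ (25 : ℝ) ≤ 2 ^ 31 * √(d : ℝ) * kappa ℓ ρ ε δ Δ := by
    have h2 : (2 : ℝ) ^ (25 : ℝ) = 2 ^ 25 := by norm_num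
    have h3 : (1 / 3 : ℝ) ≤ √(d : ℝ) * kappa ℓ ρ ε δ Δ := by nlinarith
    rw [h2, mul_assoc]
    linarith
  have h2 := (Real.le_logb_iff_rpow_le one_lt_two
    (lt_of_lt_of_le (by positivity) h1)).2 h1
  linarith [h.2.1]

/-- The middle term of the maximum, `50χ⁴ℓΔ/ε²`, dominates: the last is `ℓΔ/ε²`, and `ε² ≤ 3σΔ`
bounds the first by `χℓΔ/ε²`. -/
lemma horizon_eq {𝒯 : ℕ} (hρ : 0 < ρ) (hε : 0 < ε) (hℓ : √(ρ * ε) ≤ ℓ)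
    (hΔ : ε ^ 2 ≤ 3 * √(ρ * ε) * Δ) (hΔ0 : 0 < Δ) (hχ : 1 ≤ χ)
    (h𝒯 : (𝒯 : ℝ) = ℓ * χ / √(ρ * ε)) :
    horizon ℓ ρ ε Δ χ 𝒯 = 400 * χ ^ 4 * (ℓ * Δ / ε ^ 2) := by
  have hσ : 0 < √(ρ * ε) := Real.sqrt_pos.2 (by positivity)
  rw [horizon, decrease_eq hρ hε, h𝒯]
  set σ := √(ρ * ε)
  have hℓ0 : 0 < ℓ := hσ.trans_le hℓ
  have hX : 0 < ℓ * Δ / ε ^ 2 := by positivity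
  have h1 : Δ * (ℓ * χ / σ) / (ε ^ 2 / (50 * χ ^ 3 * σ)) = 50 * χ ^ 4 * (ℓ * Δ / ε ^ 2) := by
    field_simp
  have h2 : Δ / (1 / ℓ * ε ^ 2) = ℓ * Δ / ε ^ 2 := by field_simp
  have hχ4 : χ ≤ χ ^ 4 := le_self_pow₀ hχ (by norm_num)
  have h3 : ℓ * χ / σ / 3 ≤ χ * (ℓ * Δ / ε ^ 2) := by
    rw [div_div, ← mul_div_assoc, div_le_div_iff₀ (by positivity) (by positivity)]
    calc ℓ * χ * ε ^ 2 ≤ ℓ * χ * (3 * σ * Δ) := by gcongr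
      _ = _ := by ring
  have h4 : max (50 * χ ^ 4 * (ℓ * Δ / ε ^ 2)) (ℓ * Δ / ε ^ 2) = 50 * χ ^ 4 * (ℓ * Δ / ε ^ 2) :=
    max_eq_left (by nlinarith)
  rw [h1, h2, h4, max_eq_right (by nlinarith)]
  ring

/-- The union bound over the perturbations. -/
lemma failure_probability_le {d : ℕ} {𝒯 : ℕ} (hd : 0 < d) (hρ : 0 < ρ) (hε : 0 < ε)
    (hℓ : √(ρ * ε) ≤ ℓ) (hΔ0 : 0 < Δ) (hδ : 0 < δ) (hκ : 1 < 3 * kappa ℓ ρ ε δ Δ)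
    (h : Admissible d ℓ ρ ε δ Δ χ 𝒯) (hχ : 100 ≤ χ) :
    550 * χ ^ 3 * (√(ρ * ε) * Δ / ε ^ 2) *
      (4800 * d * χ ^ 2 * (ℓ / √(ρ * ε)) * (2 ^ χ)⁻¹) ≤ δ := by
  have hσ : 0 < √(ρ * ε) := Real.sqrt_pos.2 (by positivity)
  have hd0 : (0 : ℝ) < d := by exact_mod_cast hd
  have hκeq := kappa_eq (ℓ := ℓ) (δ := δ) (Δ := Δ) hρ hε
  have hlog := h.2.1
  set κ := kappa ℓ ρ ε δ Δ
  set σ := √(ρ * ε)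
  have hℓ0 : 0 < ℓ := hσ.trans_le hℓ
  have hκ0 : 0 < κ := by linarith
  have hχ0 : 0 < χ := by linarith
  -- Admissibility says `2^31 √d κ ≤ X`, and `2^χ = X⁴`. Two factors `X` pay for `dκ`, the other two
  -- for `χ⁵` via `(χ/4)⁵/5! ≤ exp(χ/4) ≤ X²`.
  set X : ℝ := 2 ^ (χ / 4) with hX
  have hX0 : 0 < X := by positivity
  have hX4 : (2 : ℝ) ^ χ = X ^ 4 := by
    rw [hX, ← Real.rpow_natCast, ← Real.rpow_mul two_pos.le]
    congr 1
    push_cast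
    ring
  have hXge : 2 ^ 31 * √(d : ℝ) * κ ≤ X := by
    rw [hX, ← Real.logb_le_iff_le_rpow one_lt_two (by positivity), le_div_iff₀' four_pos]
    exact hlog
  have hXsq : 2 ^ 62 * d * κ ^ 2 ≤ X ^ 2 := by
    calc 2 ^ 62 * d * κ ^ 2 = (2 ^ 31 * √(d : ℝ) * κ) ^ 2 := by
          rw [mul_pow, mul_pow, Real.sq_sqrt hd0.le]
          ring
      _ ≤ X ^ 2 := by gcongr
  have hχ5 : χ ^ 5 ≤ 122880 * X ^ 2 := by
    have h1 : X ^ 2 = Real.exp (Real.log 2 * (χ / 2)) := by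
      rw [hX, ← Real.rpow_natCast, ← Real.rpow_mul two_pos.le, Real.rpow_def_of_pos two_pos]
      congr 1
      push_cast
      ring
    have h2 : Real.exp (χ / 4) ≤ X ^ 2 := by
      rw [h1, Real.exp_le_exp]
      nlinarith [Real.log_two_gt_d9]
    have h3 := Real.pow_div_factorial_le_exp (χ / 4) (by positivity) 5
    norm_num [Nat.factorial] at h3
    linarith
  have hκδ : ℓ * Δ / ε ^ 2 ≤ κ * δ := by
    rw [hκeq, div_mul_eq_mul_div, div_le_div_iff₀ (by positivity) (by positivity)]
    calc ℓ * Δ * (δ * σ * ε ^ 2) ≤ ℓ * Δ * (δ * ℓ * ε ^ 2) := by gcongr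
      _ = _ := by ring
  have hdκ : d * κ ≤ 3 * (d * κ ^ 2) := by nlinarith [mul_pos hd0 hκ0]
  have hmain : 2640000 * (χ ^ 5 * (d * κ)) ≤ X ^ 4 := by
    have h1 : d * κ ≤ 3 / 2 ^ 62 * X ^ 2 := by linarith
    calc 2640000 * (χ ^ 5 * (d * κ)) ≤ 2640000 * (122880 * X ^ 2 * (3 / 2 ^ 62 * X ^ 2)) := by
          gcongr
      _ = 2640000 * 122880 * 3 / 2 ^ 62 * X ^ 4 := by ring
      _ ≤ 1 * X ^ 4 := by gcongr; norm_num
      _ = X ^ 4 := one_mul _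
  calc 550 * χ ^ 3 * (σ * Δ / ε ^ 2) * (4800 * d * χ ^ 2 * (ℓ / σ) * (2 ^ χ)⁻¹)
      = 2640000 * χ ^ 5 * d * (ℓ * Δ / ε ^ 2) * (2 ^ χ)⁻¹ := by field_simp; ring
    _ ≤ 2640000 * χ ^ 5 * d * (κ * δ) * (2 ^ χ)⁻¹ := by gcongr
    _ = 2640000 * (χ ^ 5 * (d * κ)) * (X ^ 4)⁻¹ * δ := by rw [hX4]; ring
    _ ≤ X ^ 4 * (X ^ 4)⁻¹ * δ := by gcongr
    _ = δ := by rw [mul_inv_cancel₀ (by positivity), one_mul]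

/-- Admissible parameters of the right size exist. -/
lemma exists_admissible {d : ℕ} (hd : 0 < d) (hρ : 0 < ρ) (hε : 0 < ε)
    (hℓ : √(ρ * ε) ≤ ℓ) (hκ : 1 < 3 * kappa ℓ ρ ε δ Δ) :
    ∃ (χ : ℝ) (𝒯 : ℕ), Admissible d ℓ ρ ε δ Δ χ 𝒯 ∧
      χ ≤ 125 * (1 + Real.log d + Real.log (3 * kappa ℓ ρ ε δ Δ)) := by
  have hσ : 0 < √(ρ * ε) := Real.sqrt_pos.2 (by positivity)
  have hd1 : (1 : ℝ) ≤ d := by exact_mod_cast hd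
  set κ := kappa ℓ ρ ε δ Δ with hκdef
  have hκ0 : 0 < κ := by linarith
  set χ₀ := 4 * Real.logb 2 (2 ^ 31 * √(d : ℝ) * κ) with hχ₀
  have hlogd : 0 ≤ Real.log d := Real.log_nonneg hd1
  have hlogκ : 0 ≤ Real.log (3 * κ) := Real.log_nonneg hκ.le
  have hlog2 := Real.log_two_gt_d9
  have hsqrt : (1 : ℝ) ≤ √(d : ℝ) := by rwa [Real.one_le_sqrt]
  have hexp : Real.log (2 ^ 31 * √(d : ℝ) * κ) =
      31 * Real.log 2 + Real.log d / 2 + Real.log κ := by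
    rw [Real.log_mul (by positivity) hκ0.ne', Real.log_mul (by positivity) (by positivity),
      Real.log_pow, Real.log_sqrt (by positivity)]
    norm_num
  have hlogκ' : Real.log κ ≤ Real.log (3 * κ) := Real.log_le_log hκ0 (by linarith)
  have hχ₀le : χ₀ ≤ 124 + 6 * (Real.log d + Real.log (3 * κ)) := by
    have h1 : Real.logb 2 (2 ^ 31 * √(d : ℝ) * κ) ≤
        31 + 3 / 2 * (Real.log d + Real.log (3 * κ)) := by
      rw [Real.logb, hexp, div_le_iff₀ (by linarith)]
      nlinarith
    calc χ₀ ≤ 4 * (31 + 3 / 2 * (Real.log d + Real.log (3 * κ))) :=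
          mul_le_mul_of_nonneg_left h1 four_pos.le
      _ = _ := by ring
  have hχ₀ge : 1 / 4 < χ₀ := by
    have h1 : (1 : ℝ) ≤ Real.logb 2 (2 ^ 31 * √(d : ℝ) * κ) := by
      rw [Real.le_logb_iff_rpow_le one_lt_two (by positivity), Real.rpow_one, mul_assoc]
      nlinarith
    linarith
  set σ := √(ρ * ε)
  have hℓ0 : 0 < ℓ := hσ.trans_le hℓ
  -- `𝒯` is rounded up and `χ` is read back from it as `𝒯σ/ℓ`; this raises `χ₀` by at most `σ/ℓ ≤
  -- 1`.
  set 𝒯 := ⌈ℓ * χ₀ / σ⌉₊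
  have h1 : ℓ * χ₀ / σ ≤ 𝒯 := Nat.le_ceil _
  have h2 : (𝒯 : ℝ) < ℓ * χ₀ / σ + 1 := Nat.ceil_lt_add_one (by positivity)
  have hge : χ₀ ≤ 𝒯 * σ / ℓ := by
    rw [le_div_iff₀ hℓ0]
    rw [div_le_iff₀ hσ] at h1
    linarith
  refine ⟨𝒯 * σ / ℓ, 𝒯, ⟨by linarith, hge, ?_⟩, ?_⟩
  · change (𝒯 : ℝ) = ℓ * (𝒯 * σ / ℓ) / σ
    field_simp
  have h3 : 𝒯 * σ / ℓ ≤ χ₀ + 1 := by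
    rw [div_le_iff₀ hℓ0]
    have h4 : 𝒯 * σ ≤ (ℓ * χ₀ / σ + 1) * σ := by gcongr
    have h5 : (ℓ * χ₀ / σ + 1) * σ = ℓ * χ₀ + σ := by field_simp
    linarith
  linarith

/-- Bernoulli's inequality `2^y ≤ 1 + y` on `[0,1]`. For `y = σ/ℓ` it turns the expansion rate at a
saddle over `𝒯` steps into `2^χ`. -/
lemma two_rpow_le_pow {𝒯 : ℕ} {y lam : ℝ} (hy : 0 ≤ y) (hy1 : y ≤ 1) (hχ : 𝒯 * y = χ)
    (hlam : 1 + y ≤ lam) : (2 : ℝ) ^ χ ≤ lam ^ 𝒯 := by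
  have h1 : (2 : ℝ) ^ y ≤ 1 + y := by
    have := rpow_one_add_le_one_add_mul_self (s := 1) (by norm_num) hy hy1
    norm_num at this
    linarith
  calc (2 : ℝ) ^ χ = ((2 : ℝ) ^ y) ^ 𝒯 := by
        rw [← Real.rpow_natCast, ← Real.rpow_mul two_pos.le, mul_comm y, hχ]
    _ ≤ lam ^ 𝒯 := by
        gcongr
        linarith

/-- The length scale `ε/σ = √(ε/ρ)` of the analysis fits into the ball where the assumptions hold.
-/
lemma ofReal_div_sqrt_le {b : ℝ≥0∞} (hρ : 0 < ρ) (hε : 0 < ε)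
    (h : ENNReal.ofReal ε ≤ b ^ 2 * ENNReal.ofReal ρ) :
    ENNReal.ofReal (ε / √(ρ * ε)) ≤ b := by
  induction b with
  | top => exact le_top
  | coe b =>
    have hb : (b : ℝ≥0∞) = ENNReal.ofReal b := (ENNReal.ofReal_coe_nnreal).symm
    rw [hb, ← ENNReal.ofReal_pow b.coe_nonneg, ← ENNReal.ofReal_mul (by positivity),
      ENNReal.ofReal_le_ofReal_iff (by positivity)] at h
    rw [hb]
    refine ENNReal.ofReal_le_ofReal (le_of_sq_le_sq ?_ b.coe_nonneg)
    rw [div_pow, Real.sq_sqrt (by positivity), div_le_iff₀ (by positivity)]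
    nlinarith

end Parameters

/-! ## Counting rounds -/

section Counting

variable {M : Type*} {V : M → Type*} [∀ x, NormedAddCommGroup (V x)]
  {p : Params} {g : ∀ x, V x} {f : M → ℝ} {Q : M → Prop} {a c F Δ : ℝ} {x₀ : M} {S : State M}

/-- The consequences of the accounting that hold for every outcome of the perturbations. -/
lemma Accounting.two_le_smallCount_and_queries_le (h : Accounting p g f Q a c (-c) x₀ S)
    (hΔ : f x₀ - f S.point ≤ Δ) (ha : 0 < a) (hc : c ≤ a / 1000) (h𝒯 : (100 : ℝ) ≤ p.𝒯)
    (hT𝒯 : 8 * p.𝒯 / 3 ≤ p.T) (hTa : 4 * Δ ≤ p.T * a) (hT : p.T < S.time) :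
    2 ≤ smallCount g p.ε S ∧ (S.queries : ℝ) ≤ 2 * p.T := by
  have htime : (S.time : ℝ) + smallCount g p.ε S =
      S.visited.length + p.𝒯 * smallCount g p.ε S := by exact_mod_cast h.time_eq
  have hval := h.value_le
  have htle := h.time_le
  have hq : (S.stepQueries : ℝ) ≤ S.time := by exact_mod_cast h.queries_le
  have hS : (S.queries : ℝ) = S.stepQueries + S.visited.length := by
    simp [State.queries]
  set N : ℕ := smallCount g p.ε S
  set n : ℝ := (S.visited.length : ℝ)
  have hN0 : (0 : ℝ) ≤ N := N.cast_nonneg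
  have hNl : n - N ≤ p.T / 4 + N / 1000 := by
    have h1 : (n - N) * a ≤ Δ + N * c := by linarith
    have h2 : N * c ≤ N * (a / 1000) := by gcongr
    have h3 : (n - N) * a ≤ (p.T / 4 + N / 1000) * a := by linarith
    exact le_of_mul_le_mul_right h3 ha
  constructor
  -- With at most one small-gradient round, the elapsed time would be at most `T/4 + 1/1000 + 𝒯 <
  -- T`, since `𝒯 ≤ 3T/8`.
  · by_contra hlt
    have hN1 : (N : ℝ) ≤ 1 := by exact_mod_cast (by omega : N ≤ 1)
    have h4 : p.𝒯 * (N : ℝ) ≤ p.𝒯 := mul_le_of_le_one_right (by linarith) hN1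
    linarith
  -- The time identity becomes `n + 99N ≤ time`; with the bound on `n - N` this leaves fewer than
  -- `T/2` tests.
  · have h5 : 100 * (N : ℝ) ≤ p.𝒯 * N := by gcongr
    linarith

/-- The consequence of the accounting for the number of rounds at saddle points. -/
lemma Accounting.two_mul_smallCount_le (h : Accounting p g f Q a c F x₀ S)
    (hΔ : f x₀ - f S.point ≤ Δ) (hΔ0 : 0 < Δ) (ha : 0 < a) (hF : 0 < F)
    (hc : c ≤ 5 / 32 * F) (hTF : 8 * Δ * p.𝒯 ≤ p.T * F) (hTa : 4 * Δ ≤ p.T * a)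
    (hT : p.T < S.time) :
    2 * smallCount g p.ε S ≤ 3 * goodCount g p.ε Q S := by
  by_contra! hlt
  have htime : (S.time : ℝ) + smallCount g p.ε S =
      S.visited.length + p.𝒯 * smallCount g p.ε S := by exact_mod_cast h.time_eq
  have hval := h.value_le
  have hlen : (smallCount g p.ε S : ℝ) ≤ S.visited.length := by
    exact_mod_cast smallCount_le_length g p.ε S
  have hgs : (goodCount g p.ε Q S : ℝ) ≤ smallCount g p.ε S := by
    exact_mod_cast goodCount_le_smallCount g p.ε Q S
  have hlt' : 3 * (goodCount g p.ε Q S : ℝ) < 2 * smallCount g p.ε S := by exact_mod_cast hlt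
  have hg0 : (0 : ℝ) ≤ goodCount g p.ε Q S := Nat.cast_nonneg _
  set N : ℝ := (smallCount g p.ε S : ℝ)
  set Ng : ℝ := (goodCount g p.ε Q S : ℝ)
  set n : ℝ := (S.visited.length : ℝ)
  have hT0 : 0 < p.T := by
    by_contra hcon
    nlinarith
  have h𝒯0 : (0 : ℝ) ≤ p.𝒯 := Nat.cast_nonneg _
  -- `X` and `Y` are the decreases credited to large-gradient and saddle rounds. Under `hlt` the
  -- good rounds return at most `(5/16)Y`, so `X + (11/16)Y ≤ Δ`. The elapsed time is at most `T(2X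
  -- + 3Y)/(8Δ) ≤ T`, a contradiction.
  set X := (n - N) * a with hX
  set Y := (N - Ng) * F with hY
  have hX0 : 0 ≤ X := mul_nonneg (by linarith) ha.le
  have hY0 : 0 ≤ Y := mul_nonneg (by linarith) hF.le
  have h1 : Ng * c ≤ 2 * (N - Ng) * (5 / 32 * F) := by
    calc Ng * c ≤ Ng * (5 / 32 * F) := by gcongr
      _ ≤ _ := by gcongr; linarith
  have h2 : X + 11 / 16 * Y ≤ Δ := by
    rw [hX, hY] at *
    linarith
  have h3 : 4 * Δ * (n - N) ≤ p.T * X := by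
    have := mul_le_mul_of_nonneg_right hTa (sub_nonneg.2 hlen)
    rw [hX]
    linarith
  have h4 : 8 * Δ * (p.𝒯 * (N - Ng)) ≤ p.T * Y := by
    have := mul_le_mul_of_nonneg_right hTF (sub_nonneg.2 hgs)
    rw [hY]
    linarith
  have h5 : p.T < (n - N) + 3 * (p.𝒯 * (N - Ng)) := by
    have : p.𝒯 * N ≤ p.𝒯 * (3 * (N - Ng)) := by gcongr; linarith
    linarith
  have h6 : 8 * Δ * p.T < 8 * Δ * ((n - N) + 3 * (p.𝒯 * (N - Ng))) := by gcongr
  have h7 : 8 * Δ * p.T < p.T * (2 * X + 3 * Y) := by linarith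
  have h8 : p.T * (2 * X + 3 * Y) ≤ p.T * (8 * Δ) := by gcongr; linarith
  linarith

end Counting

/-! ## One round of the loop -/

section Round

variable {V : Type*} [NormedAddCommGroup V] [InnerProductSpace ℝ V] [CompleteSpace V]
  {φ : V → ℝ} {b : ℝ≥0∞} {ℓ ρ ε χ : ℝ} {𝒯 : ℕ}

lemma GradLipschitz.large_round (hφ : ContDiff ℝ 2 φ) (hG : GradLipschitz φ b ℓ) (hρ : 0 < ρ)
    (hε : 0 < ε) (hℓ : √(ρ * ε) ≤ ℓ) (hb : ENNReal.ofReal (ε / √(ρ * ε)) ≤ b)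
    (hg : ε < ‖gradient φ 0‖) :
    φ (PRGD.tangentSpaceSteps (gradient φ) (1 / ℓ) b 1 0).1 ≤ φ 0 - ε ^ 2 / (2 * ℓ) := by
  have hσ : 0 < √(ρ * ε) := Real.sqrt_pos.2 (by positivity)
  have hℓ0 : 0 < ℓ := hσ.trans_le hℓ
  have h1 := hG.large_gradient hφ (η := 1 / ℓ) (by positivity) hℓ0.le
    (one_div_mul_cancel hℓ0.ne').le hε.le
    (lt_of_lt_of_le (ENNReal.ofReal_pos.2 (by positivity)) hb)
    (le_trans (ENNReal.ofReal_le_ofReal (by rw [one_div_mul_eq_div]; gcongr)) hb) hg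
  refine h1.trans (le_of_eq ?_)
  field_simp

lemma step_radius_le (hρ : 0 < ρ) (hε : 0 < ε) (hℓ : √(ρ * ε) ≤ ℓ) (hχ : 100 ≤ χ) :
    1 / ℓ * (ε / (400 * χ ^ 3)) ≤ ε / √(ρ * ε) / χ / 1000 := by
  have hσ : 0 < √(ρ * ε) := Real.sqrt_pos.2 (by positivity)
  have hℓ0 : 0 < ℓ := hσ.trans_le hℓ
  have hχ2 : 1000 ≤ 400 * χ ^ 2 := by nlinarith
  have hχ0 : 0 < χ := by linarith
  calc 1 / ℓ * (ε / (400 * χ ^ 3)) = ε / (ℓ * χ * (400 * χ ^ 2)) := by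
        rw [div_mul_div_comm, one_mul]
        congr 1
        ring
    _ ≤ ε / (√(ρ * ε) * χ * 1000) := by gcongr
    _ = _ := by rw [div_div, div_div, mul_assoc]

lemma GradLipschitz.apply_le_of_norm_le (hφ : ContDiff ℝ 2 φ) (hG : GradLipschitz φ b ℓ)
    (hρ : 0 < ρ) (hε : 0 < ε) (hℓ : √(ρ * ε) ≤ ℓ)
    (hb : ENNReal.ofReal (ε / √(ρ * ε)) ≤ b) (hχ : 100 ≤ χ) (hg : ‖gradient φ 0‖ ≤ ε) {s : V}
    (hs : ‖s‖ ≤ 1 / ℓ * (ε / (400 * χ ^ 3))) :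
    ‖s‖ₑ < b ∧ φ s ≤ φ 0 + ε ^ 2 / (320 * ℓ * χ ^ 3) := by
  have hσ : 0 < √(ρ * ε) := Real.sqrt_pos.2 (by positivity)
  have hℓ0 : 0 < ℓ := hσ.trans_le hℓ
  have hχ0 : 0 < χ := by linarith
  have hlt : ‖s‖ < ε / √(ρ * ε) := by
    refine (hs.trans (step_radius_le hρ hε hℓ hχ)).trans_lt ?_
    rw [div_div]
    exact div_lt_self (by positivity) (by linarith)
  have hsb : ‖s‖ₑ < b := by
    refine lt_of_lt_of_le ?_ hb
    rw [← ofReal_norm]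
    exact (ENNReal.ofReal_lt_ofReal_iff (by positivity)).2 hlt
  refine ⟨hsb, (hG.apply_perturbation_le hφ hℓ0.le hε.le hg hsb.le hs).trans ?_⟩
  have h3 : (1 : ℝ) ≤ χ ^ 3 := one_le_pow₀ (by linarith)
  -- The linear term contributes `1/400` and the quadratic one at most `1/320000`, together below
  -- `1/320`.
  have h1 : ε * (1 / ℓ * (ε / (400 * χ ^ 3))) + ℓ / 2 * (1 / ℓ * (ε / (400 * χ ^ 3))) ^ 2 =
      ε ^ 2 / (ℓ * χ ^ 3) * (1 / 400 + 1 / 320000 / χ ^ 3) := by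
    field_simp
    ring
  have h2 : ε ^ 2 / (320 * ℓ * χ ^ 3) = ε ^ 2 / (ℓ * χ ^ 3) * (1 / 320) := by
    field_simp
  rw [add_assoc, h1, h2]
  gcongr
  have : 1 / 320000 / χ ^ 3 ≤ 1 / 320000 := div_le_self (by norm_num) h3
  linarith

lemma GradLipschitz.small_round (hφ : ContDiff ℝ 2 φ) (hG : GradLipschitz φ b ℓ) (hρ : 0 < ρ)
    (hε : 0 < ε) (hℓ : √(ρ * ε) ≤ ℓ) (hb : ENNReal.ofReal (ε / √(ρ * ε)) ≤ b) (hχ : 100 ≤ χ)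
    (hg : ‖gradient φ 0‖ ≤ ε) {ξ : V} (hξ : ‖ξ‖ ≤ ε / (400 * χ ^ 3)) :
    φ (PRGD.tangentSpaceSteps (gradient φ) (1 / ℓ) b 𝒯 ((1 / ℓ) • ξ)).1 ≤
      φ 0 + ε ^ 2 / (320 * ℓ * χ ^ 3) := by
  have hσ : 0 < √(ρ * ε) := Real.sqrt_pos.2 (by positivity)
  have hℓ0 : 0 < ℓ := hσ.trans_le hℓ
  have hs : ‖(1 / ℓ) • ξ‖ ≤ 1 / ℓ * (ε / (400 * χ ^ 3)) := by
    rw [norm_smul, Real.norm_of_nonneg (by positivity)]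
    gcongr
  obtain ⟨h1, h2⟩ := hG.apply_le_of_norm_le hφ hρ hε hℓ hb hχ hg hs
  exact (hG.tangentSpaceSteps hφ (by positivity) hℓ0.le (one_div_mul_cancel hℓ0.ne').le 𝒯 h1).1.trans
    h2

lemma perturbation_le_decrease (hρ : 0 < ρ) (hε : 0 < ε) (hℓ : √(ρ * ε) ≤ ℓ) (hχ : 100 ≤ χ) :
    ε ^ 2 / (320 * ℓ * χ ^ 3) ≤ 5 / 32 * decrease ρ ε χ := by
  have hσ : 0 < √(ρ * ε) := Real.sqrt_pos.2 (by positivity)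
  have hχ0 : 0 < χ := by linarith
  rw [decrease_eq hρ hε]
  calc ε ^ 2 / (320 * ℓ * χ ^ 3) ≤ ε ^ 2 / (320 * √(ρ * ε) * χ ^ 3) := by gcongr
    _ = 5 / 32 * (ε ^ 2 / (50 * χ ^ 3 * √(ρ * ε))) := by field_simp; norm_num

/-- At a strict saddle point, a round decreases the function with high probability. -/
lemma GradLipschitz.saddle_round [FiniteDimensional ℝ V] [Nontrivial V] (hφ : ContDiff ℝ 2 φ)
    (hG : GradLipschitz φ b ℓ) (hH : HessBound φ b ρ) (hA : ‖hessian φ 0‖ ≤ ℓ) (hρ : 0 < ρ)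
    (hε : 0 < ε) (hℓ : √(ρ * ε) ≤ ℓ) (hb : ENNReal.ofReal (ε / √(ρ * ε)) ≤ b) (hχ : 100 ≤ χ)
    (h𝒯 : (𝒯 : ℝ) = ℓ * χ / √(ρ * ε)) (hg : ‖gradient φ 0‖ ≤ ε)
    (hlam : lambdaMin (hessian φ 0) < -√(ρ * ε)) :
    uniformBall V (ε / (400 * χ ^ 3)) {ξ | ‖ξ‖ ≤ ε / (400 * χ ^ 3) ∧
      φ 0 - decrease ρ ε χ <
        φ (PRGD.tangentSpaceSteps (gradient φ) (1 / ℓ) b 𝒯 ((1 / ℓ) • ξ)).1} ≤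
      ENNReal.ofReal
        (4800 * Module.finrank ℝ V * χ ^ 2 * (ℓ / √(ρ * ε)) * (2 ^ χ)⁻¹) := by
  have hσ : 0 < √(ρ * ε) := Real.sqrt_pos.2 (by positivity)
  have hσsq : √(ρ * ε) ^ 2 = ρ * ε := Real.sq_sqrt (by positivity)
  have hℓ0 : 0 < ℓ := hσ.trans_le hℓ
  have hχ0 : 0 < χ := by linarith
  have hq := step_radius_le hρ hε hℓ hχ
  have hc := perturbation_le_decrease hρ hε hℓ hχ
  have hinc : ∀ s : V, ‖s‖ ≤ 1 / ℓ * (ε / (400 * χ ^ 3)) →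
      φ s + decrease ρ ε χ ≤ φ 0 + 37 / 32 * decrease ρ ε χ := fun s hs => by
    have := (hG.apply_le_of_norm_le hφ hρ hε hℓ hb hχ hg hs).2
    linarith
  have hdec := decrease_eq (χ := χ) hρ hε
  set σ := √(ρ * ε)
  -- With `R = u/4`, `3ηρR𝒯 = 3/4`. With `D = ℱ + (5/32)ℱ`, `2𝒯ηD = (37/800)u²`, below `(0.249u)²`;
  -- the perturbation uses at most `u/1000` of the radius.
  set u := ε / σ / χ with hu
  have hu0 : 0 < u := by positivity
  -- Chosen so that `2^χ ηw = 8R`, twice the separation that the ball permits.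
  set w := 8 * (u / 4) * ℓ * (2 ^ χ)⁻¹ with hw
  have hw0 : 0 < w := by positivity
  have hpow : (2 : ℝ) ^ χ ≤ (1 - 1 / ℓ * lambdaMin (hessian φ 0)) ^ 𝒯 := by
    refine two_rpow_le_pow (y := σ / ℓ) (by positivity) ((div_le_one hℓ0).2 hℓ)
      (by rw [h𝒯]; field_simp) ?_
    have : 1 / ℓ * lambdaMin (hessian φ 0) ≤ 1 / ℓ * (-σ) := by gcongr
    have h2 : 1 / ℓ * (-σ) = -(σ / ℓ) := by ring
    linarith
  refine (uniformBall_setOf_not_decrease_le hφ hρ.le hH hG (η := 1 / ℓ) (n := 𝒯)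
    (F := decrease ρ ε χ) (D := 37 / 32 * decrease ρ ε χ) (R := u / 4) (w := w)
    (by positivity) hℓ0.le (one_div_mul_cancel hℓ0.ne').le hA (by linarith) (by positivity)
    hw0 (by linarith) ?_ ?_ hinc ?_ ?_).trans (le_of_eq ?_)
  · refine lt_of_lt_of_le ((ENNReal.ofReal_lt_ofReal_iff (by positivity)).2 ?_) hb
    rw [hu, div_div]
    exact div_lt_self (by positivity) (by linarith)
  · rw [h𝒯, hu]
    have : 3 * (1 / ℓ * ρ * (ε / σ / χ / 4)) * (ℓ * χ / σ) = 3 / 4 * ((ρ * ε) / σ ^ 2) := by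
      field_simp
    rw [this, hσsq, div_self (by positivity)]
    norm_num
  · have h1 : 2 * 𝒯 * (1 / ℓ) * (37 / 32 * decrease ρ ε χ) = 37 / 800 * u ^ 2 := by
      rw [h𝒯, hdec, hu]
      field_simp
      norm_num
    have h2 : (249 / 1000 * u) ^ 2 ≤ (u / 4 - 1 / ℓ * (ε / (400 * χ ^ 3))) ^ 2 := by
      gcongr
      linarith
    rw [h1]
    nlinarith [sq_nonneg u]
  · calc 4 * (u / 4) < 8 * (u / 4) := by linarith
      _ = 2 ^ χ * (1 / ℓ * w) := by
          rw [hw]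
          field_simp
      _ ≤ _ := by gcongr
  · congr 1
    rw [hw, hu]
    field_simp
    ring

end Round

end PRGD

end

/-! ### Assembling the rounds, the counting and the parameters -/

theorem mainTheorem1 :
    ∃ C : ℝ, 0 < C ∧
    ∀ (d : ℕ), 0 < d →
    ∀ (M : Type*) [TopologicalSpace M] [ChartedSpace (EuclideanSpace ℝ (Fin d)) M]
      [IsManifold (𝓡 d) ∞ M]
      [Bundle.RiemannianBundle (fun x : M => TangentSpace (𝓡 d) x)]
      [IsContMDiffRiemannianBundle (𝓡 d) ∞ (EuclideanSpace ℝ (Fin d))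
        (fun x : M => TangentSpace (𝓡 d) x)]
      (Retr : TangentBundle (𝓡 d) M → M), PRGD.IsRetraction Retr →
    ∀ (f : M → ℝ), ContMDiff (𝓡 d) 𝓘(ℝ, ℝ) 2 f →
    ∀ (fstar : ℝ), (∀ x, fstar ≤ f x) →
    ∀ (b₁ b₂ b : ℝ≥0∞) (L ρ : ℝ), 0 < b₁ → 0 < b₂ → b = min b₁ b₂ → 0 < L → 0 < ρ →
      (∀ x, PRGD.GradBound (PRGD.pullback Retr f x) b₁ L) →
      (∀ x, PRGD.HessBound (PRGD.pullback Retr f x) b₂ ρ) →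
      -- a Lipschitz constant `ℓ ∈ [L, L + ρ b]` exists (for finite `b`)
      (b ≠ ⊤ → ∃ ℓ, L ≤ ℓ ∧ ℓ ≤ L + ρ * b.toReal ∧
        ∀ x, PRGD.GradLipschitz (PRGD.pullback Retr f x) b ℓ) ∧
      ∀ (ℓ : ℝ), L ≤ ℓ → (∀ x, PRGD.GradLipschitz (PRGD.pullback Retr f x) b ℓ) →
      ∀ (x₀ : M) (ε δ Δ : ℝ), Δ = f x₀ - fstar →
        0 < ε → ENNReal.ofReal ε ≤ b ^ 2 * ENNReal.ofReal ρ → √(ρ * ε) ≤ L →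
        ε ^ (3 / 2 : ℝ) ≤ 3 * √ρ * Δ → 0 < δ → δ < 1 →
        -- admissible parameters exist, with `T = O(ℓ Δ (log d)⁴ / ε²)`
        (∃ (χ : ℝ) (𝒯 : ℕ), PRGD.Admissible d ℓ ρ ε δ Δ χ 𝒯 ∧
          PRGD.horizon ℓ ρ ε Δ χ 𝒯 ≤ C * (ℓ * Δ / ε ^ 2) *
            (1 + Real.log d + Real.log (3 * PRGD.kappa ℓ ρ ε δ Δ)) ^ 4 ∧
          (2 ≤ d → PRGD.horizon ℓ ρ ε Δ χ 𝒯 ≤ C *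
            (1 + Real.log (3 * PRGD.kappa ℓ ρ ε δ Δ)) ^ 4 *
              (ℓ * Δ / ε ^ 2 * Real.log d ^ 4))) ∧
        -- the guarantees hold for all admissible parameters
        ∀ (χ : ℝ) (𝒯 : ℕ), PRGD.Admissible d ℓ ρ ε δ Δ χ 𝒯 →
          ∀ (p : PRGD.Params), p = PRGD.params ℓ ρ ε Δ χ 𝒯 b →
          -- for every outcome of the perturbations
          (∀ ζ : ℕ → ∀ x : M, TangentSpace (𝓡 d) x, (∀ k x, ‖ζ k x‖ ≤ p.r) →
            ∀ S : PRGD.State M,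
              S = PRGD.run p (PRGD.grad f) (fun x => gradient (PRGD.pullback Retr f x))
                (fun x s => Retr ⟨x, s⟩) x₀ ζ →
              p.T < S.time ∧
              2 ≤ PRGD.numSmallGrad d f ε S ∧
              (S.time : ℝ) ≤ p.T + 𝒯 ∧ (S.stepQueries : ℝ) ≤ p.T + 𝒯 ∧ p.T + 𝒯 ≤ 2 * p.T ∧
              (S.queries : ℝ) ≤ 2 * p.T) ∧
          -- with probability at least `1 - δ`
          ENNReal.ofReal (1 - δ) ≤
            PRGD.prob p (PRGD.grad f) (fun x => gradient (PRGD.pullback Retr f x))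
              (fun x s => Retr ⟨x, s⟩) x₀
              {S | 2 * PRGD.numSmallGrad d f ε S ≤ 3 * PRGD.numSecondOrder Retr f ρ ε S} := by
  refine ⟨400 * 375 ^ 4, by norm_num, ?_⟩
  intro d hd M _ _ _ _ _ Retr hRetr f hf fstar hfstar b₁ b₂ b L ρ hb₁ hb₂ hb hL hρ hA2 hA3
  have hb0 : 0 < b := by rw [hb]; exact lt_min hb₁ hb₂
  have hφ : ∀ x, ContDiff ℝ 2 (PRGD.pullback Retr f x) := PRGD.contDiff_pullback hRetr hf
  have hGB : ∀ x, PRGD.GradBound (PRGD.pullback Retr f x) b L := fun x s hs =>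
    hA2 x s (hs.trans (hb.trans_le (min_le_left _ _)))
  have hHB : ∀ x, PRGD.HessBound (PRGD.pullback Retr f x) b ρ := fun x s hs =>
    hA3 x s (hs.trans (hb.trans_le (min_le_right _ _)))
  refine ⟨fun hbt => ⟨L + ρ * b.toReal, le_add_of_nonneg_right (by positivity), le_rfl,
    fun x => (hHB x).gradLipschitz (hφ x) hb0 hbt hL.le hρ.le (hGB x)⟩, ?_⟩
  intro ℓ hLℓ hG x₀ ε δ Δ hΔ hε hεb hσL hε32 hδ hδ1
  have hσ : 0 < √(ρ * ε) := Real.sqrt_pos.2 (by positivity)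
  have hσℓ : √(ρ * ε) ≤ ℓ := hσL.trans hLℓ
  have hℓ : 0 < ℓ := hσ.trans_le hσℓ
  have hΔsq := PRGD.sq_le_of_rpow_le hρ hε hε32
  have hΔ0 : 0 < Δ := by
    have : 0 < 3 * √(ρ * ε) * Δ := (pow_pos hε 2).trans_le hΔsq
    exact pos_of_mul_pos_right this (by positivity)
  have hκ := PRGD.one_lt_three_mul_kappa hρ hε hσℓ hΔsq hδ hδ1
  have hbσ := PRGD.ofReal_div_sqrt_le hρ hε hεb
  have hX : 0 < ℓ * Δ / ε ^ 2 := by positivity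
  refine ⟨?_, ?_⟩
  · obtain ⟨χ, 𝒯, hadm, hχle⟩ := PRGD.exists_admissible hd hρ hε hσℓ hκ
    have hχ := hadm.hundred_le hd hκ
    have hT := PRGD.horizon_eq hρ hε hσℓ hΔsq hΔ0 (by linarith) hadm.2.2
    refine ⟨χ, 𝒯, hadm, ?_, fun hd2 => ?_⟩
    · rw [hT]
      set Λ := 1 + Real.log d + Real.log (3 * PRGD.kappa ℓ ρ ε δ Δ)
      have hΛ : 0 ≤ Λ := by linarith
      calc 400 * χ ^ 4 * (ℓ * Δ / ε ^ 2) ≤ 400 * (375 * Λ) ^ 4 * (ℓ * Δ / ε ^ 2) := by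
            gcongr
            linarith
        _ = _ := by ring
    · rw [hT]
      have hlogκ : 0 ≤ Real.log (3 * PRGD.kappa ℓ ρ ε δ Δ) := Real.log_nonneg hκ.le
      have hlogd : 1 / 2 ≤ Real.log d := by
        have : Real.log 2 ≤ Real.log d := Real.log_le_log two_pos (by exact_mod_cast hd2)
        linarith [Real.log_two_gt_d9]
      set k := Real.log (3 * PRGD.kappa ℓ ρ ε δ Δ)
      -- `log d ≥ 1/2` gives `1 + k + log d ≤ 3(1 + k) log d`, whence `375 = 3 · 125`.
      have hle : χ ≤ 375 * ((1 + k) * Real.log d) := by nlinarith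
      calc 400 * χ ^ 4 * (ℓ * Δ / ε ^ 2)
          ≤ 400 * (375 * ((1 + k) * Real.log d)) ^ 4 * (ℓ * Δ / ε ^ 2) := by gcongr
        _ = _ := by ring
  · intro χ 𝒯 hadm p hp
    have hχ := hadm.hundred_le hd hκ
    have hχ0 : 0 < χ := by linarith
    have h𝒯 := hadm.2.2
    have hT := PRGD.horizon_eq hρ hε hσℓ hΔsq hΔ0 (by linarith) h𝒯
    have h𝒯100 : (100 : ℝ) ≤ 𝒯 := by
      rw [h𝒯, le_div_iff₀ hσ]
      nlinarith
    have h𝒯1 : 1 ≤ 𝒯 := by exact_mod_cast (by linarith : (1 : ℝ) ≤ 𝒯)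
    set a := ε ^ 2 / (2 * ℓ) with ha
    set c := ε ^ 2 / (320 * ℓ * χ ^ 3) with hc
    have ha0 : 0 < a := by positivity
    have hca : c ≤ a / 1000 := by
      have h3 : (100 : ℝ) ^ 3 ≤ χ ^ 3 := by gcongr
      rw [hc, ha, div_div]
      gcongr <;> linarith
    have hF0 : 0 < PRGD.decrease ρ ε χ := by
      rw [PRGD.decrease_eq hρ hε]
      positivity
    have hT𝒯 : 8 * (𝒯 : ℝ) / 3 ≤ PRGD.horizon ℓ ρ ε Δ χ 𝒯 := by
      rw [PRGD.horizon, mul_div_assoc]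
      gcongr
      exact le_max_left _ _
    have hTF : 8 * Δ * 𝒯 ≤ PRGD.horizon ℓ ρ ε Δ χ 𝒯 * PRGD.decrease ρ ε χ := by
      rw [← div_le_iff₀ hF0, PRGD.horizon, mul_assoc, mul_div_assoc]
      gcongr
      exact (le_max_left _ _).trans (le_max_right _ _)
    have hTa : 4 * Δ ≤ PRGD.horizon ℓ ρ ε Δ χ 𝒯 * a := by
      have h1 : 8 * (Δ / (1 / ℓ * ε ^ 2)) ≤ PRGD.horizon ℓ ρ ε Δ χ 𝒯 := by
        rw [PRGD.horizon]
        gcongr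
        exact (le_max_right _ _).trans (le_max_right _ _)
      calc 4 * Δ = 8 * (Δ / (1 / ℓ * ε ^ 2)) * a := by
            rw [ha]
            field_simp
            norm_num
        _ ≤ _ := by gcongr
    have hTpos : 0 ≤ PRGD.horizon ℓ ρ ε Δ χ 𝒯 := by linarith
    have hrounds : p.T < p.rounds := by
      rw [PRGD.Params.rounds]
      push_cast
      exact Nat.lt_floor_add_one _
    have hpη : p.η = 1 / ℓ := by rw [hp]; rfl
    have hpr : p.r = ε / (400 * χ ^ 3) := by rw [hp]; rfl
    have hp𝒯 : p.𝒯 = 𝒯 := by rw [hp]; rfl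
    have hpε : p.ε = ε := by rw [hp]; rfl
    have hpT : p.T = PRGD.horizon ℓ ρ ε Δ χ 𝒯 := by rw [hp]; rfl
    have hpb : p.b = b := by rw [hp]; rfl
    have hzero : ∀ x, PRGD.pullback Retr f x 0 = f x := PRGD.pullback_zero hRetr
    have hgrad : ∀ x, gradient (PRGD.pullback Retr f x) 0 = PRGD.grad f x :=
      PRGD.gradient_pullback_zero hRetr hf
    set Q : M → Prop := fun x =>
      -√(ρ * ε) ≤ PRGD.lambdaMin (PRGD.hessian (PRGD.pullback Retr f x) 0) with hQ
    have hlarge : ∀ x, p.ε < ‖PRGD.grad (d := d) f x‖ →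
        f (Retr ⟨x, (PRGD.tangentSpaceSteps (gradient (PRGD.pullback Retr f x)) p.η p.b 1 0).1⟩) ≤
          f x - a := by
      intro x hx
      rw [hpη, hpb]
      rw [hpε, ← hgrad x] at hx
      rw [← hzero x]
      exact (hG x).large_round (hφ x) hρ hε hσℓ hbσ hx
    have hsmall : ∀ x, ‖PRGD.grad (d := d) f x‖ ≤ p.ε →
        ∀ ξ : TangentSpace (𝓡 d) x, ‖ξ‖ ≤ p.r →
        f (Retr ⟨x, (PRGD.tangentSpaceSteps (gradient (PRGD.pullback Retr f x)) p.η p.b p.𝒯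
          (p.η • ξ)).1⟩) ≤ f x + c := by
      intro x hx ξ hξ
      rw [hpη, hpb]
      rw [hpε, ← hgrad x] at hx
      rw [hpr] at hξ
      rw [← hzero x]
      exact (hG x).small_round (hφ x) hρ hε hσℓ hbσ hχ hx hξ
    have hacc : ∀ F, PRGD.Accounting p (PRGD.grad (d := d) f) f Q a c F x₀
        (PRGD.State.init x₀) := fun F => PRGD.Accounting.init (by rw [hpT]; exact hTpos)
    refine ⟨?_, ?_⟩
    · intro ζ hζ S hS
      -- Taking `F = -c` asks of saddle rounds only the increase bound that holds for every
      -- perturbation.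
      obtain ⟨h1, h2⟩ := (hacc (-c)).exec (by rw [hp𝒯]; exact h𝒯1)
        (G := fun x => gradient (PRGD.pullback Retr f x)) (R := fun x s => Retr ⟨x, s⟩) hlarge
        (fun x hx _ => hsmall x hx) (fun x hx _ ξ hξ => by
          rw [sub_neg_eq_add]
          exact hsmall x hx ξ hξ) hζ p.rounds (by simpa [PRGD.State.init] using hrounds)
      have hSe : S = PRGD.exec p (PRGD.grad (d := d) f)
        (fun x => gradient (PRGD.pullback Retr f x)) (fun x s => Retr ⟨x, s⟩) ζ p.rounds
        (PRGD.State.init x₀) := hS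
      rw [← hSe] at h1 h2
      obtain ⟨h3, h4⟩ := h1.two_le_smallCount_and_queries_le (Δ := Δ)
        (by rw [hΔ]; linarith [hfstar S.point]) ha0 hca (by rw [hp𝒯]; exact h𝒯100)
        (by rw [hp𝒯, hpT]; exact hT𝒯) (by rw [hpT]; exact hTa) h2
      have h5 := h1.time_le
      rw [hp𝒯] at h5
      rw [hpε] at h3
      refine ⟨h2, h3, h5, ?_, ?_, h4⟩
      · exact le_trans (by exact_mod_cast h1.queries_le) h5
      · rw [hpT]
        linarith
    · set q := 4800 * d * χ ^ 2 * (ℓ / √(ρ * ε)) * ((2 : ℝ) ^ χ)⁻¹ with hq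
      have hq0 : 0 ≤ q := by positivity
      have hsaddle : ∀ x, ‖PRGD.grad (d := d) f x‖ ≤ p.ε → ¬ Q x →
          PRGD.uniformBall (TangentSpace (𝓡 d) x) p.r {ξ | ‖ξ‖ ≤ p.r ∧ f x - PRGD.decrease ρ ε χ <
            f (Retr ⟨x, (PRGD.tangentSpaceSteps (gradient (PRGD.pullback Retr f x)) p.η p.b p.𝒯
              (p.η • ξ)).1⟩)} ≤ ENNReal.ofReal q := by
        intro x hx hQx
        rw [hpη, hpb, hpr, hp𝒯]
        rw [hpε, ← hgrad x] at hx
        have hfr := PRGD.finrank_tangentSpace (d := d) x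
        have : Nontrivial (TangentSpace (𝓡 d) x) :=
          Module.nontrivial_of_finrank_pos (R := ℝ) (by rw [hfr]; exact hd)
        have h1 := (hG x).saddle_round (hφ x) (hHB x)
          (((hGB x).norm_hessian_zero_le (hφ x) hb0 hL.le).trans hLℓ) hρ hε hσℓ hbσ hχ h𝒯 hx
          (not_le.1 hQx)
        rw [hfr, hzero x] at h1
        exact h1
      set m := ⌊p.T / 𝒯⌋₊ + 1 with hm
      have h𝒯pos : (0 : ℝ) < 𝒯 := by linarith
      have hmT : p.T < m * 𝒯 := by
        rw [← div_lt_iff₀ h𝒯pos, hm]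
        push_cast
        exact Nat.lt_floor_add_one _
      -- `𝒯 ≤ 3T/8` gives `m ≤ T/𝒯 + 1 ≤ (11/8)T/𝒯`, and `550 = 400 · 11/8`.
      have hmle : (m : ℝ) ≤ 550 * χ ^ 3 * (√(ρ * ε) * Δ / ε ^ 2) := by
        have h1 : (m : ℝ) ≤ p.T / 𝒯 + 1 := by
          rw [hm]
          push_cast
          gcongr
          exact Nat.floor_le (by rw [hpT]; positivity)
        have h2 : 1 ≤ 3 / 8 * (p.T / 𝒯) := by
          rw [← mul_div_assoc, le_div_iff₀ h𝒯pos, hpT]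
          linarith
        have h3 : p.T / 𝒯 = 400 * χ ^ 3 * (√(ρ * ε) * Δ / ε ^ 2) := by
          rw [hpT, hT, h𝒯]
          field_simp
        linarith
      have hfail : m * q ≤ δ := by
        refine le_trans ?_ (PRGD.failure_probability_le hd hρ hε hσℓ hΔ0 hδ hκ hadm hχ)
        rw [← hq]
        gcongr
      refine le_trans (ENNReal.ofReal_le_ofReal (by linarith))
        ((hacc (PRGD.decrease ρ ε χ)).le_expect (by rw [hp𝒯]; exact h𝒯1)
          (by rw [hpr]; positivity) (G := fun x => gradient (PRGD.pullback Retr f x))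
          (R := fun x s => Retr ⟨x, s⟩) hlarge (fun x hx _ => hsmall x hx) hq0 hsaddle ?_ p.rounds
          (m := m) (by simpa [PRGD.State.init] using hrounds)
          (by rw [hp𝒯]; simpa [PRGD.State.init] using hmT))
      intro S h1 h2
      have h3 := h1.two_mul_smallCount_le (Δ := Δ) (by rw [hΔ]; linarith [hfstar S.point]) hΔ0 ha0
        hF0 (PRGD.perturbation_le_decrease hρ hε hσℓ hχ) (by rw [hp𝒯, hpT]; exact hTF)
        (by rw [hpT]; exact hTa) h2
      rw [hpε] at h3
      rw [Set.indicator_of_mem (show S ∈ {S | 2 * PRGD.numSmallGrad d f ε S ≤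
        3 * PRGD.numSecondOrder Retr f ρ ε S} from h3)]
      exact le_rfl
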